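/- **Setting.** Let $G=(V,E)$ be a connected undirected graph on $N$ agents $V=\{1,\dots,N\}$, $A=\{1,\dots,K\}$ a set of $K\ge 2$ actions, $d\ge 0$ an integer delay, and $\ell_t\in[0,1]^K$, $t\ge 1$, loss vectors fixed in advance (oblivious adversary). Let $N_{\le d}(v)$ be the set of agents at shortest-path distance at most $d$ from $v$ (including $v$), $G_{\le d}$ the graph on $V$ in which distinct agents are adjacent iff their distance in $G$ is at most $d$, and $\alpha(\cdot)$ the independence number. **Exp3-Coop with local doubling trick.** Put $$\gamma_r=Ke(d+1)\sqrt{(\ln K)/2^r},\qquad r_0=\bigl\lceil \log_2\ln K+2\log_2(Ke(d+1))\bigr\rceil ,$$ so that $\gamma_r\in(0,1]$ for all integers $r\ge r_0$. Each agent $v$ starts with $r=r_0$ and weights $w_1(i,v)=1$, $i\in A$. In round $t=1,2,\dots$, given the past, the agents draw their actions $I_t(v)$ independently from $p_t(i,v)=w_t(i,v)/\sum_{j\in A} w_t(j,v)$. At the end of round $t$, call agent $v$ *active* if more than $d$ rounds, round $t$ included, have been played since its last (re)start. If $v$ is active it computes $$\widehat\ell_t(i,v)=\frac{\ell_{t-d}(i)}{q_{d,t-d}(i,v)}\,\mathbb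 1\{\exists v'\in N_{\le d}(v): I_{t-d}(v')=i\},\qquad q_{d,t-d}(i,v)=1-\prod_{v'\in N_{\le d}(v)}\bigl(1-p_{t-d}(i,v')\bigr),$$ $$Q_t(v)=d+\frac e2\sum_{i=1}^K\frac{p_{t-d}(i,v)}{q_{d,t-d}(i,v)},$$ and otherwise $\widehat\ell_t(\cdot,v)=0$ and $Q_t(v)=0$. If the sum of the $Q_s(v)$ over the rounds $s\le t$ since the last (re)start of $v$ exceeds $2^r$, where $\gamma_r$ is the value $v$ is currently using, then $v$ restarts at round $t+1$ with $\gamma_{r+1}$: all its weights are reset to $1$ and its sum to $0$. Otherwise $w_{t+1}(i,v)=p_t(i,v)\exp\bigl(-\eta(v)\widehat\ell_t(i,v)\bigr)$ with $\eta(v)=\gamma_r/(Ke(d+1))$. The average welfare regret is $$R_T^{\mathrm{coop}}=\frac1N\sum_{v\in V}\mathbb E\Bigl[\sum_{t=1}^T\ell_t(I_t(v))\Bigr]-\min_{i\in A}\sum_{t=1}^T\ell_t(i).$$ **Theorem.** There are a universal constant $C$ and a polynomial $P$ with real coefficients in three variables such that for all $N$, $K\ge2$, $d\ge 0$, all connected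 $G$ on $N$ agents, all loss sequences in $[0,1]^K$ and all $T\ge1$, $$R_T^{\mathrm{coop}}\le C\left(\sqrt{(\ln K)\Bigl(d+1+\frac KN\,\alpha(G_{\le d})\Bigr)T}+d\ln T\right)+P(N,K,d).$$ That is, $R_T^{\mathrm{coop}}=O\bigl(\sqrt{(\ln K)(d+1+\frac KN\alpha(G_{\le d}))T}+d\log T\bigr)$ as $T$ grows, where the big-oh hides additive terms independent of $T$ and polynomial in the other parameters. -/

import Mathlib

namespace Exp3Coop

noncomputable section

open Classical in
/-- `N_{≤ d}(v)`: the agents at shortest-path distance at most `d` from `v` in `G`. -/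
def ball {N : ℕ} (G : SimpleGraph (Fin N)) (d : ℕ) (v : Fin N) : Finset (Fin N) :=
  Finset.univ.filter fun u => G.edist v u ≤ (d : ℕ∞)

/-- `G_{≤ d}`, the `d`-th power of `G`. -/
def graphPower {N : ℕ} (G : SimpleGraph (Fin N)) (d : ℕ) : SimpleGraph (Fin N) where
  Adj u v := u ≠ v ∧ G.edist u v ≤ (d : ℕ∞)
  symm := ⟨fun u v h => ⟨h.1.symm, by rw [SimpleGraph.edist_comm]; exact h.2⟩⟩
  loopless := ⟨fun _ h => h.1 rfl⟩

/-- The actions played by all the agents in one round. -/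
abbrev Profile (N K : ℕ) : Type := Fin N → Fin K

/-- The actions played in rounds `1, …, t`, the most recent round first:
`[I_t, I_{t-1}, …, I_1]`. -/
abbrev History (N K : ℕ) : Type := List (Profile N K)

/-! ### The doubling schedule -/

/-- `r₀ = ⌈log₂ (ln K) + 2 log₂ (K e (d+1))⌉`. -/
def r0 (K d : ℕ) : ℤ :=
  ⌈Real.logb 2 (Real.log K) + 2 * Real.logb 2 (K * Real.exp 1 * (d + 1))⌉

/-- `γ_r = K e (d+1) √((ln K) / 2^r)`. -/
def gammaR (K d : ℕ) (r : ℤ) : ℝ :=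
  K * Real.exp 1 * (d + 1) * Real.sqrt (Real.log K / (2 : ℝ) ^ r)

/-- The learning rate `η = γ_r / (K e (d+1))`. -/
def eta (K d : ℕ) (r : ℤ) : ℝ :=
  gammaR K d r / (K * Real.exp 1 * (d + 1))

/-! ### The local algorithm of an agent -/

/-- The local memory of an agent at the beginning of a round. -/
structure AgentState (K : ℕ) where
  /-- the weights `w(i)` -/
  w : Fin K → ℝ
  /-- the index `r` of the value `γ_r` in use -/
  r : ℤ
  /-- the number of rounds completed since the last (re)start -/
  age : ℕ
  /-- the sum of the `Q_s` over these rounds -/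
  acc : ℝ

/-- The memory of an agent that (re)starts its algorithm with `γ_r`. -/
def AgentState.start (K : ℕ) (r : ℤ) : AgentState K where
  w := fun _ => 1
  r := r
  age := 0
  acc := 0

/-- The distribution `p(i) = w(i) / W` from which the agent draws its action. -/
def AgentState.p {K : ℕ} (s : AgentState K) (i : Fin K) : ℝ :=
  s.w i / ∑ j, s.w j

/-- The end of a round in which the agent computed the loss estimates `est` and the
quantity `Q`: if the accumulated sum of the `Q_s` now exceeds `2^r`, the agent restarts with
`γ_{r+1}`; otherwise it performs the exponential update. -/
def AgentState.next {K : ℕ} (d : ℕ) (s : AgentState K) (est : Fin K → ℝ) (Q : ℝ) :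
    AgentState K :=
  if (2 : ℝ) ^ s.r < s.acc + Q then
    AgentState.start K (s.r + 1)
  else
    { w := fun i => s.p i * Real.exp (-(eta K d s.r) * est i)
      r := s.r
      age := s.age + 1
      acc := s.acc + Q }

section Estimates

variable {N K : ℕ} (G : SimpleGraph (Fin N)) (d : ℕ)

/-- `q(i,v) = 1 - ∏_{u ∈ N_{≤ d}(v)} (1 - p(i,u))`; here `p u i` is the probability that agent
`u` plays `i`. -/
def q (p : Fin N → Fin K → ℝ) (i : Fin K) (v : Fin N) : ℝ :=
  1 - ∏ u ∈ ball G d v, (1 - p u i)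

open Classical in
/-- `B(i,v)`: the indicator of the event that some agent of `N_{≤ d}(v)` played `i`. -/
def B (a : Profile N K) (i : Fin K) (v : Fin N) : ℝ :=
  if ∃ u ∈ ball G d v, a u = i then 1 else 0

/-- The importance-weighted estimate `ℓ(i) / q(i,v) * B(i,v)`, for the round in which the
distributions were `p`, the actions `a` and the losses `l`. -/
def lossEstimate (p : Fin N → Fin K → ℝ) (a : Profile N K) (l : Fin K → ℝ)
    (v : Fin N) (i : Fin K) : ℝ :=
  l i / q G d p i v * B G d a i v

/-- `d + (e/2) ∑_i p(i,v) / q(i,v)`. -/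
def Qterm (p : Fin N → Fin K → ℝ) (v : Fin N) : ℝ :=
  d + Real.exp 1 / 2 * ∑ i, p v i / q G d p i v

end Estimates

section Run

variable {N K : ℕ} (G : SimpleGraph (Fin N)) (d : ℕ) (l : ℕ → Fin K → ℝ)

/-- The memories of all the agents after the rounds listed in the history, when `l t i` is the
loss of action `i` in round `t`.

At the end of round `t`, that is for a history `a :: h` of length `t`, dropping the `d` last
rounds leaves `b :: past` exactly when `t > d`; then `b` is the profile played in round `t - d`
and `past` is the history before round `t - d`. The estimates and `Q_t(v)` are `0` during the
first `d` rounds after a (re)start of agent `v`. -/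
def state : History N K → Fin N → AgentState K
  | [] => fun _ => AgentState.start K (r0 K d)
  | a :: h => fun v =>
    match hd : (a :: h).drop d with
    | [] => (state h v).next d (fun _ => 0) 0
    | b :: past =>
      if d < (state h v).age + 1 then
        (state h v).next d
          (lossEstimate G d (fun u => (state past u).p) b (l (past.length + 1)) v)
          (Qterm G d (fun u => (state past u).p) v)
      else
        (state h v).next d (fun _ => 0) 0
termination_by h => h.length
decreasing_by
  all_goals first
    | (simp only [List.length_cons]; omega)
    | (have := congrArg List.length hd
       simp only [List.length_drop, List.length_cons] at this ⊢
       omega)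

/-- `p_{t+1}(i,v)` after the history `h` of the rounds `1, …, t`. -/
def prob (h : History N K) (v : Fin N) (i : Fin K) : ℝ :=
  (state G d l h v).p i

/-- The expectation of `f(I_T, …, I_1)`: given the history of the first `T` rounds, the actions
`I_{T+1}(v)` are drawn independently over the agents `v`, each from `p_{T+1}(v)`. -/
def expect : ℕ → (History N K → ℝ) → ℝ
  | 0, f => f []
  | T + 1, f => expect T fun h =>
      ∑ a : Profile N K, (∏ v, prob G d l h v (a v)) * f (a :: h)

/-- The total loss `∑_t ℓ_t(I_t(v))` of agent `v` along a history. -/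
def cumLoss (v : Fin N) : History N K → ℝ
  | [] => 0
  | a :: h => cumLoss v h + l (h.length + 1) (a v)

/-- The average welfare regret `R_T^coop` of the algorithm with local doubling trick. -/
def regret (T : ℕ) : ℝ :=
  (1 / (N : ℝ)) * ∑ v, expect G d l T (cumLoss l v)
    - ⨅ i : Fin K, ∑ t ∈ Finset.Icc 1 T, l t i

end Run

/-! ### The definitions describe probabilities -/

theorem AgentState.next_pos {K d : ℕ} {s : AgentState K} (hs : ∀ i, 0 < s.w i)
    (est : Fin K → ℝ) (Q : ℝ) (i : Fin K) : 0 < (s.next d est Q).w i := by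
  unfold AgentState.next
  split_ifs
  · simp [AgentState.start]
  · have : 0 < ∑ j, s.w j := Finset.sum_pos (fun j _ => hs j) ⟨i, Finset.mem_univ i⟩
    exact mul_pos (div_pos (hs i) this) (Real.exp_pos _)

theorem state_pos {N K : ℕ} (G : SimpleGraph (Fin N)) (d : ℕ) (l : ℕ → Fin K → ℝ)
    (h : History N K) (v : Fin N) (i : Fin K) : 0 < (state G d l h v).w i := by
  induction h generalizing i with
  | nil => simp [state, AgentState.start]
  | cons a h ih =>
    rw [state]
    split
    · exact AgentState.next_pos ih _ _ i
    · dsimp only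
      split_ifs
      · exact AgentState.next_pos ih _ _ i
      · exact AgentState.next_pos ih _ _ i

theorem prob_pos {N K : ℕ} (G : SimpleGraph (Fin N)) (d : ℕ) (l : ℕ → Fin K → ℝ)
    (h : History N K) (v : Fin N) (i : Fin K) : 0 < prob G d l h v i :=
  div_pos (state_pos G d l h v i)
    (Finset.sum_pos (fun j _ => state_pos G d l h v j) ⟨i, Finset.mem_univ i⟩)

theorem sum_prob {N K : ℕ} (hK : 0 < K) (G : SimpleGraph (Fin N)) (d : ℕ)
    (l : ℕ → Fin K → ℝ) (h : History N K) (v : Fin N) : ∑ i, prob G d l h v i = 1 := by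
  have hp : 0 < ∑ j, (state G d l h v).w j :=
    Finset.sum_pos (fun j _ => state_pos G d l h v j) ⟨⟨0, hK⟩, Finset.mem_univ _⟩
  simp only [prob, AgentState.p, ← Finset.sum_div]
  exact div_self hp.ne'

theorem expect_const {N K : ℕ} (hK : 0 < K) (G : SimpleGraph (Fin N)) (d : ℕ)
    (l : ℕ → Fin K → ℝ) (T : ℕ) (c : ℝ) : expect G d l T (fun _ => c) = c := by
  induction T with
  | zero => rfl
  | succ T ih =>
    have key : ∀ h : History N K, ∑ a : Profile N K, ∏ v, prob G d l h v (a v) = 1 := by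
      intro h
      have := Finset.prod_univ_sum (fun _ : Fin N => (Finset.univ : Finset (Fin K)))
        (fun v i => prob G d l h v i)
      simp only [sum_prob hK, Finset.prod_const_one, Fintype.piFinset_univ] at this
      exact this.symm
    simp only [expect, ← Finset.sum_mul, key, one_mul]
    exact ih

/-- The values `γ_r` used by the agents are admissible. -/
theorem gammaR_mem {K : ℕ} (hK : 2 ≤ K) (d : ℕ) {r : ℤ} (hr : r0 K d ≤ r) :
    gammaR K d r ∈ Set.Ioc (0 : ℝ) 1 := by
  have hK' : (1 : ℝ) < K := by exact_mod_cast hK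
  have hlog : 0 < Real.log K := Real.log_pos hK'
  have hm : (0 : ℝ) < K * Real.exp 1 * (d + 1) := by positivity
  have h2 : (0 : ℝ) < (2 : ℝ) ^ r := by positivity
  set m : ℝ := K * Real.exp 1 * (d + 1) with hmdef
  refine ⟨mul_pos hm (Real.sqrt_pos.2 (div_pos hlog h2)), ?_⟩
  have h1 : Real.logb 2 (Real.log K) + 2 * Real.logb 2 m ≤ (r : ℝ) :=
    (Int.le_ceil _).trans (by exact_mod_cast hr)
  have h3 : Real.logb 2 (Real.log K * m ^ 2) ≤ (r : ℝ) := by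
    rw [Real.logb_mul hlog.ne' (by positivity), Real.logb_pow]
    exact_mod_cast h1
  have h4 : Real.log K * m ^ 2 ≤ (2 : ℝ) ^ r := by
    rw [Real.logb_le_iff_le_rpow (by norm_num) (by positivity), Real.rpow_intCast] at h3
    exact h3
  have h5 : m * Real.sqrt (Real.log K / (2 : ℝ) ^ r)
      = Real.sqrt (m ^ 2 * (Real.log K / (2 : ℝ) ^ r)) := by
    rw [Real.sqrt_mul (by positivity), Real.sqrt_sq hm.le]
  show m * Real.sqrt (Real.log K / (2 : ℝ) ^ r) ≤ 1
  rw [h5, Real.sqrt_le_iff, ← mul_div_assoc, one_pow, div_le_one h2]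
  exact ⟨zero_le_one, by linarith⟩

end

end Exp3Coop

namespace Exp3Coop

noncomputable section

/-! ### Elementary inequalities -/

/-! The regret of an agent in round s is charged to the end of round t = s + d, when the loss
estimate ê of round s arrives. If the agent is then active and does not restart, p_s is replaced by
p_t. An update lowers p(j) by at most η p(j) ê(j) (`sub_expUpdate_le`), and the estimates are
unbiased, so each of the d rounds in between costs at most η in mean (`sum_expect_drift_le`). What
remains is the exponential-weights regret against the estimates: (ln K)/η per epoch plus a
second-order term. Over d rounds of one epoch a probability grows at most by (1 + 1/d)^d ≤ e
(`prob_le_pow_mul`), and ê² has conditional mean at most 1/q, so the second-order term is at most η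
(Q - d). Together with the drift this is η Q, which explains the form of Q.

An epoch of index r therefore costs O(√((ln K) 2^r)). These costs grow geometrically, so the last
epoch dominates. A restart also wastes at most d + 1 rounds, and there are O(log T) restarts. Each
of these costs is bounded by the increment of a potential of the agent's memory and summed by
`sum_expect_le_of_potential`.

Random restarts do not spoil unbiasedness: Q_t involves the distributions of round t - d but not its
actions, so the activity, the restart decision and the rate at the end of round t are fixed before
the draw of round t - d (`r_age_eq`).

To size the last epoch, note that 2^r + acc grows by at most Q per round. Summed over agents, Q is
at most Nd + 3(N + Kα), by a weighted Caro–Wei bound applied to each action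
(`exists_indep_sum_div_le`, `sum_Qterm_le`). Concavity of the square root then turns the average of
2^r into the average regret. -/

theorem exp_neg_le_quadratic {x : ℝ} (hx : 0 ≤ x) : Real.exp (-x) ≤ 1 - x + x ^ 2 / 2 := by
  have h1 := Real.quadratic_le_exp_of_nonneg hx
  have h2 : Real.exp (-x) * Real.exp x = 1 := by rw [← Real.exp_add]; simp
  have h3 := Real.exp_pos (-x)
  have h4 : 0 < 1 + x + x ^ 2 / 2 := by positivity
  have h5 : Real.exp (-x) * (1 + x + x ^ 2 / 2) ≤ 1 := by
    exact (mul_le_mul_of_nonneg_left h1 h3.le).trans h2.le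
  have h6 : (1 - x + x ^ 2 / 2) * (1 + x + x ^ 2 / 2) = 1 + x ^ 4 / 4 := by ring
  have h7 : 0 ≤ x ^ 4 := by positivity
  exact le_of_mul_le_mul_right (by linarith) h4

theorem half_min_le_one_sub_exp_neg {x : ℝ} (hx : 0 ≤ x) :
    min 1 x / 2 ≤ 1 - Real.exp (-x) := by
  rcases le_total x 1 with h | h
  · rw [min_eq_right h]
    have := exp_neg_le_quadratic hx
    nlinarith
  · rw [min_eq_left h]
    have h1 := exp_neg_le_quadratic (zero_le_one (α := ℝ))
    have h2 : Real.exp (-x) ≤ Real.exp (-1) := Real.exp_le_exp.2 (by linarith)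
    linarith

/-! ### One step of exponential weights -/

section Update

variable {ι : Type*} [Fintype ι] {p e : ι → ℝ} {η : ℝ}

theorem sum_mul_exp_neg_pos (hp : ∀ i, 0 < p i) (hs : ∑ i, p i = 1) :
    0 < ∑ j, p j * Real.exp (-η * e j) := by
  have : Nonempty ι := by
    by_contra h
    rw [not_nonempty_iff] at h
    simp at hs
  exact Finset.sum_pos (fun j _ => mul_pos (hp j) (Real.exp_pos _)) Finset.univ_nonempty

theorem sum_mul_exp_neg_le (hp : ∀ i, 0 < p i) (hs : ∑ i, p i = 1) (he : ∀ i, 0 ≤ e i)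
    (hη : 0 < η) :
    ∑ j, p j * Real.exp (-η * e j) ≤
      1 - η * ∑ j, p j * e j + η ^ 2 / 2 * ∑ j, p j * e j ^ 2 := by
  rw [← hs, Finset.mul_sum, Finset.mul_sum, ← Finset.sum_sub_distrib, ← Finset.sum_add_distrib]
  refine Finset.sum_le_sum fun j _ => ?_
  have h := exp_neg_le_quadratic (mul_nonneg hη.le (he j))
  rw [neg_mul]
  nlinarith [mul_le_mul_of_nonneg_left h (hp j).le]

theorem le_sum_mul_exp_neg (hp : ∀ i, 0 < p i) (hs : ∑ i, p i = 1) :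
    1 - η * ∑ j, p j * e j ≤ ∑ j, p j * Real.exp (-η * e j) := by
  rw [← hs, Finset.mul_sum, ← Finset.sum_sub_distrib]
  refine Finset.sum_le_sum fun j _ => ?_
  nlinarith [mul_le_mul_of_nonneg_left (Real.add_one_le_exp (-η * e j)) (hp j).le]

theorem sum_mul_exp_neg_le_one (hp : ∀ i, 0 < p i) (hs : ∑ i, p i = 1) (he : ∀ i, 0 ≤ e i)
    (hη : 0 < η) : ∑ j, p j * Real.exp (-η * e j) ≤ 1 := by
  rw [← hs]
  refine Finset.sum_le_sum fun j _ => mul_le_of_le_one_right (hp j).le ?_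
  rw [Real.exp_le_one_iff]
  nlinarith [mul_nonneg hη.le (he j)]

/-- One step of exponential weights decreases the probability of `i` by at most `η p(i) e(i)`. -/
theorem sub_expUpdate_le (hp : ∀ i, 0 < p i) (hs : ∑ i, p i = 1) (he : ∀ i, 0 ≤ e i)
    (hη : 0 < η) (i : ι) :
    p i - p i * Real.exp (-η * e i) / ∑ j, p j * Real.exp (-η * e j) ≤ η * (p i * e i) := by
  have h1 := sum_mul_exp_neg_pos (e := e) (η := η) hp hs
  have h2 := sum_mul_exp_neg_le_one hp hs he hη
  have h3 : 0 ≤ p i * Real.exp (-η * e i) := mul_nonneg (hp i).le (Real.exp_pos _).le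
  have h4 : p i * Real.exp (-η * e i) ≤
      p i * Real.exp (-η * e i) / ∑ j, p j * Real.exp (-η * e j) := by
    rw [le_div_iff₀ h1]
    exact mul_le_of_le_one_right h3 h2
  nlinarith [mul_le_mul_of_nonneg_left (Real.add_one_le_exp (-η * e i)) (hp i).le]

/-- One step of exponential weights does not increase any probability too much. -/
theorem expUpdate_le (hp : ∀ i, 0 < p i) (hs : ∑ i, p i = 1) (he : ∀ i, 0 ≤ e i)
    (hη : 0 < η) {c : ℝ} (hc : 1 ≤ c * (1 - η * ∑ j, p j * e j)) (hc0 : 0 ≤ c) (i : ι) :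
    p i * Real.exp (-η * e i) / ∑ j, p j * Real.exp (-η * e j) ≤ c * p i := by
  have h1 := sum_mul_exp_neg_pos (e := e) (η := η) hp hs
  have h2 := le_sum_mul_exp_neg (e := e) (η := η) hp hs
  rw [div_le_iff₀ h1]
  have h3 : Real.exp (-η * e i) ≤ 1 := by
    rw [Real.exp_le_one_iff]
    nlinarith [mul_nonneg hη.le (he i)]
  have h4 : 1 ≤ c * ∑ j, p j * Real.exp (-η * e j) :=
    hc.trans (mul_le_mul_of_nonneg_left h2 hc0)
  nlinarith [mul_le_mul_of_nonneg_left h3 (hp i).le, mul_le_mul_of_nonneg_left h4 (hp i).le]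

/-- The one-step regret inequality of exponential weights. -/
theorem expUpdate_regret (hp : ∀ i, 0 < p i) (hs : ∑ i, p i = 1) (he : ∀ i, 0 ≤ e i)
    (hη : 0 < η) (i : ι) :
    (∑ j, p j * e j) - e i - η / 2 * ∑ j, p j * e j ^ 2 ≤
      Real.log (p i * Real.exp (-η * e i) / ∑ j, p j * Real.exp (-η * e j)) / η
        - Real.log (p i) / η := by
  have h1 := sum_mul_exp_neg_pos (e := e) (η := η) hp hs
  have h2 := sum_mul_exp_neg_le hp hs he hη
  have h3 := Real.log_le_sub_one_of_pos h1
  rw [Real.log_div (mul_pos (hp i) (Real.exp_pos _)).ne' h1.ne',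
    Real.log_mul (hp i).ne' (Real.exp_pos _).ne', Real.log_exp, ← sub_div, le_div_iff₀ hη]
  nlinarith

end Update

/-! ### Sums of ratios over closed neighbourhoods -/

open Classical in
/-- A weighted form of the Caro–Wei bound. -/
theorem exists_indep_sum_div_le {V : Type*} [Fintype V] (H : SimpleGraph V) {p : V → ℝ}
    (hp : ∀ v, 0 < p v) (S : Finset V) :
    ∃ I ⊆ S, H.IsIndepSet (I : Set V) ∧
      ∑ v ∈ S, p v / ∑ u ∈ S.filter (fun u => u = v ∨ H.Adj v u), p u ≤ (I.card : ℝ) := by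
  induction S using Finset.strongInduction with
  | H S ih =>
    rcases S.eq_empty_or_nonempty with rfl | hne
    · exact ⟨∅, by simp, by simp [SimpleGraph.IsIndepSet], by simp⟩
    set P : V → ℝ := fun v => ∑ u ∈ S.filter (fun u => u = v ∨ H.Adj v u), p u with hP
    -- Greedy choice: every denominator in the closed neighbourhood of the minimiser `v` is at least
    -- `P v`, so that neighbourhood contributes at most 1. Deleting it only shrinks the other
    -- denominators, so induction bounds the rest.
    obtain ⟨v, hv, hmin⟩ := S.exists_min_image P hne
    have hPpos : ∀ u ∈ S, 0 < P u := fun u hu =>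
      Finset.sum_pos (fun w _ => hp w) ⟨u, by simp [hu]⟩
    set S' := S.filter (fun u => ¬ (u = v ∨ H.Adj v u)) with hS'
    have hss : S' ⊂ S := by
      refine Finset.filter_ssubset.2 ⟨v, hv, by simp⟩
    obtain ⟨I, hIS, hI, hle⟩ := ih S' hss
    have hvI : v ∉ I := fun h => by
      have := hIS h
      simp [hS'] at this
    refine ⟨insert v I, ?_, ?_, ?_⟩
    · exact Finset.insert_subset hv (hIS.trans hss.subset)
    · rw [Finset.coe_insert]
      intro a ha b hb hab
      have key : ∀ w ∈ I, ¬ H.Adj v w := fun w hw => by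
        have := hIS hw
        simp only [hS', Finset.mem_filter, not_or] at this
        exact this.2.2
      rcases ha with rfl | ha <;> rcases hb with rfl | hb
      · exact absurd rfl hab
      · exact key b hb
      · exact fun h => key a ha h.symm
      · exact hI ha hb hab
    · rw [Finset.card_insert_of_notMem hvI, Nat.cast_add, Nat.cast_one, add_comm,
        ← Finset.sum_filter_add_sum_filter_not S (fun u => u = v ∨ H.Adj v u)]
      refine add_le_add ?_ (le_trans (Finset.sum_le_sum fun u hu => ?_) hle)
      · calc ∑ u ∈ S.filter (fun u => u = v ∨ H.Adj v u), p u / P u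
            ≤ ∑ u ∈ S.filter (fun u => u = v ∨ H.Adj v u), p u / P v := by
              refine Finset.sum_le_sum fun u hu => ?_
              have hu := (Finset.mem_filter.1 hu).1
              exact div_le_div_of_nonneg_left (hp u).le (hPpos v hv) (hmin u hu)
          _ = 1 := by
              rw [← Finset.sum_div]
              exact div_self (hPpos v hv).ne'
      · refine div_le_div_of_nonneg_left (hp u).le ?_ ?_
        · exact Finset.sum_pos (fun w _ => hp w) ⟨u, Finset.mem_filter.2 ⟨hu, Or.inl rfl⟩⟩
        · exact Finset.sum_le_sum_of_subset_of_nonneg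
            (Finset.filter_subset_filter _ hss.subset) fun w _ _ => (hp w).le

section Ratio

variable {N K : ℕ} (G : SimpleGraph (Fin N)) (d : ℕ)

theorem self_mem_ball (v : Fin N) : v ∈ ball G d v := by
  simp [ball]

theorem mem_ball_iff {u v : Fin N} : u ∈ ball G d v ↔ u = v ∨ (graphPower G d).Adj v u := by
  simp only [ball, Finset.mem_filter, Finset.mem_univ, true_and, graphPower]
  constructor
  · intro h
    by_cases huv : u = v
    · exact Or.inl huv
    · exact Or.inr ⟨fun h => huv h.symm, h⟩
  · rintro (rfl | h)
    · simp
    · exact h.2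

theorem sum_div_sum_ball_le {p : Fin N → ℝ} (hp : ∀ v, 0 < p v) :
    ∑ v, p v / ∑ u ∈ ball G d v, p u ≤ ((graphPower G d).indepNum : ℝ) := by
  classical
  obtain ⟨I, -, hI, hle⟩ := exists_indep_sum_div_le (graphPower G d) hp Finset.univ
  have hI' : (I.card : ℝ) ≤ ((graphPower G d).indepNum : ℝ) := by
    exact_mod_cast hI.card_le_indepNum
  refine le_trans (le_of_eq (Finset.sum_congr rfl fun v _ => ?_)) (hle.trans hI')
  congr 1
  exact Finset.sum_congr (by ext u; simp [mem_ball_iff]) fun _ _ => rfl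

theorem le_q {p : Fin N → Fin K → ℝ} {i : Fin K} (hp : ∀ v, 0 ≤ p v i) (hp1 : ∀ v, p v i ≤ 1)
    (v : Fin N) : p v i ≤ q G d p i v := by
  classical
  unfold q
  rw [← Finset.mul_prod_erase _ _ (self_mem_ball G d v)]
  have h : ∏ u ∈ (ball G d v).erase v, (1 - p u i) ≤ 1 :=
    Finset.prod_le_one (fun u _ => sub_nonneg.2 (hp1 u)) fun u _ => by linarith [hp u]
  nlinarith [mul_le_mul_of_nonneg_left h (sub_nonneg.2 (hp1 v))]

/-- With P the mass of the action in the ball, q ≥ 1 - e^{-P} ≥ min(1, P)/2, and 1/min(1, P) ≤ 1 +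
1/P. This trades q for the sum P, to which the Caro–Wei bound applies. -/
theorem div_q_le {p : Fin N → Fin K → ℝ} {i : Fin K} (hp : ∀ v, 0 < p v i)
    (hp1 : ∀ v, p v i ≤ 1) (v : Fin N) :
    p v i / q G d p i v ≤ 2 * p v i + 2 * (p v i / ∑ u ∈ ball G d v, p u i) := by
  set P := ∑ u ∈ ball G d v, p u i with hP
  have hPpos : 0 < P := Finset.sum_pos (fun u _ => hp u) ⟨v, self_mem_ball G d v⟩
  have hprod : ∏ u ∈ ball G d v, (1 - p u i) ≤ Real.exp (-P) := by
    rw [hP, ← Finset.sum_neg_distrib, Real.exp_sum]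
    refine Finset.prod_le_prod (fun u _ => sub_nonneg.2 (hp1 u)) fun u _ => ?_
    linarith [Real.add_one_le_exp (-p u i)]
  have hq : min 1 P / 2 ≤ q G d p i v := by
    unfold q
    linarith [half_min_le_one_sub_exp_neg hPpos.le]
  have hm : 0 < min 1 P := lt_min one_pos hPpos
  calc p v i / q G d p i v ≤ p v i / (min 1 P / 2) :=
        div_le_div_of_nonneg_left (hp v).le (by positivity) hq
    _ ≤ 2 * p v i + 2 * (p v i / P) := by
        have h1 : 0 < p v i / P := div_pos (hp v) hPpos
        have h2 := hp v
        rcases le_total 1 P with h | h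
        · rw [min_eq_left h]; linarith
        · rw [min_eq_right h]
          have : p v i / (P / 2) = 2 * (p v i / P) := by field_simp
          linarith

/-- Summing `div_q_le`, the terms 2p add up to 2N and each action contributes at most 2α. The factor
e/2 turns the 2 into e < 3. -/
theorem sum_Qterm_le {p : Fin N → Fin K → ℝ} (hp : ∀ v i, 0 < p v i) (hs : ∀ v, ∑ i, p v i = 1) :
    ∑ v, Qterm G d p v ≤
      N * d + 3 * (N + K * ((graphPower G d).indepNum : ℝ)) := by
  have hp1 : ∀ v i, p v i ≤ 1 := fun v i => by
    rw [← hs v]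
    exact Finset.single_le_sum (fun j _ => (hp v j).le) (Finset.mem_univ i)
  have h1 : ∑ v, ∑ i, p v i / q G d p i v ≤ 2 * N + 2 * (K * ((graphPower G d).indepNum : ℝ)) := by
    calc ∑ v, ∑ i, p v i / q G d p i v
        ≤ ∑ v, ∑ i, (2 * p v i + 2 * (p v i / ∑ u ∈ ball G d v, p u i)) :=
          Finset.sum_le_sum fun v _ => Finset.sum_le_sum fun i _ =>
            div_q_le G d (fun v => hp v i) (fun v => hp1 v i) v
      _ = 2 * N + 2 * ∑ i, ∑ v, p v i / ∑ u ∈ ball G d v, p u i := by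
          simp only [Finset.sum_add_distrib, ← Finset.mul_sum, hs]
          rw [Finset.sum_comm]
          simp
      _ ≤ 2 * N + 2 * ∑ _i : Fin K, ((graphPower G d).indepNum : ℝ) := by
          gcongr with i
          exact sum_div_sum_ball_le G d fun v => hp v i
      _ = _ := by simp
  have he := Real.exp_one_lt_d9
  have h0 : (0 : ℝ) ≤ N + K * ((graphPower G d).indepNum : ℝ) := by positivity
  have he0 := Real.exp_pos 1
  simp only [Qterm, Finset.sum_add_distrib, ← Finset.mul_sum]
  have h2 := mul_le_mul_of_nonneg_left h1 (by positivity : 0 ≤ Real.exp 1 / 2)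
  simp only [Finset.sum_const, Finset.card_univ, Fintype.card_fin, nsmul_eq_mul]
  nlinarith

theorem Qterm_nonneg {p : Fin N → Fin K → ℝ} (hp : ∀ v i, 0 < p v i)
    (hs : ∀ v, ∑ i, p v i = 1) (v : Fin N) : 0 ≤ Qterm G d p v := by
  have hp1 : ∀ v i, p v i ≤ 1 := fun v i => by
    rw [← hs v]
    exact Finset.single_le_sum (fun j _ => (hp v j).le) (Finset.mem_univ i)
  unfold Qterm
  have : 0 ≤ ∑ i, p v i / q G d p i v := Finset.sum_nonneg fun i _ =>
    div_nonneg (hp v i).le ((hp v i).le.trans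
      (le_q G d (fun v => (hp v i).le) (fun v => hp1 v i) v))
  positivity

theorem Qterm_le {p : Fin N → Fin K → ℝ} (hp : ∀ v i, 0 < p v i)
    (hs : ∀ v, ∑ i, p v i = 1) (v : Fin N) : Qterm G d p v ≤ d + 2 * K := by
  have hp1 : ∀ v i, p v i ≤ 1 := fun v i => by
    rw [← hs v]
    exact Finset.single_le_sum (fun j _ => (hp v j).le) (Finset.mem_univ i)
  have h1 : ∑ i, p v i / q G d p i v ≤ K := by
    calc ∑ i, p v i / q G d p i v ≤ ∑ _i : Fin K, (1 : ℝ) := by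
          refine Finset.sum_le_sum fun i _ => ?_
          have h := le_q G d (fun v => (hp v i).le) (fun v => hp1 v i) v
          exact (div_le_one ((hp v i).trans_le h)).2 h
      _ = K := by simp
  unfold Qterm
  have he := Real.exp_one_lt_d9
  have he0 := Real.exp_pos 1
  have hK : (0 : ℝ) ≤ K := by positivity
  nlinarith [mul_le_mul_of_nonneg_left h1 (by positivity : 0 ≤ Real.exp 1 / 2)]

end Ratio

/-! ### The learning rates -/

theorem eta_eq {K d : ℕ} (hK : 2 ≤ K) (r : ℤ) :
    eta K d r = Real.sqrt (Real.log K / (2 : ℝ) ^ r) := by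
  have hm : (0 : ℝ) < K * Real.exp 1 * (d + 1) := by
    have : (0 : ℝ) < K := by exact_mod_cast (by omega : 0 < K)
    positivity
  rw [eta, gammaR, mul_div_cancel_left₀ _ hm.ne']

theorem log_pos_of_two_le {K : ℕ} (hK : 2 ≤ K) : 0 < Real.log K :=
  Real.log_pos (by exact_mod_cast hK)

theorem eta_pos {K d : ℕ} (hK : 2 ≤ K) (r : ℤ) : 0 < eta K d r := by
  rw [eta_eq hK]
  have := log_pos_of_two_le hK
  positivity

/-- This is γ_r ≤ 1, in the form that keeps the probabilities stable over d rounds. -/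
theorem eta_mul_le {K d : ℕ} (hK : 2 ≤ K) {r : ℤ} (hr : r0 K d ≤ r) :
    eta K d r * (K * Real.exp 1) ≤ 1 / (d + 1) := by
  have hK0 : (0 : ℝ) < K := by exact_mod_cast (by omega : 0 < K)
  have hm : (0 : ℝ) < K * Real.exp 1 * (d + 1) := by positivity
  have hd : (0 : ℝ) < (d : ℝ) + 1 := by positivity
  rw [le_div_iff₀ hd, mul_assoc, eta, div_mul_cancel₀ _ hm.ne']
  exact (gammaR_mem hK d hr).2

/-- The bound `√((ln K) 2^r)` on each of the two terms of the regret of an epoch. -/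
def epochScale (K : ℕ) (r : ℤ) : ℝ := Real.sqrt (Real.log K * (2 : ℝ) ^ r)

theorem epochScale_nonneg (K : ℕ) (r : ℤ) : 0 ≤ epochScale K r := Real.sqrt_nonneg _

/-- The rate η = √((ln K)/2^r) balances the two costs of an epoch: η times the budget 2^r here, and
(ln K)/η in `log_div_eta`. -/
theorem eta_mul_two_zpow {K d : ℕ} (hK : 2 ≤ K) (r : ℤ) :
    eta K d r * (2 : ℝ) ^ r = epochScale K r := by
  have h2 : (0 : ℝ) < (2 : ℝ) ^ r := by positivity
  have hl := log_pos_of_two_le hK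
  rw [eta_eq hK, epochScale]
  symm
  rw [Real.sqrt_eq_iff_mul_self_eq (by positivity) (by positivity), mul_mul_mul_comm,
    Real.mul_self_sqrt (by positivity)]
  field_simp

theorem log_div_eta {K d : ℕ} (hK : 2 ≤ K) (r : ℤ) :
    Real.log K / eta K d r = epochScale K r := by
  have h2 : (0 : ℝ) < (2 : ℝ) ^ r := by positivity
  have hl := log_pos_of_two_le hK
  rw [div_eq_iff (eta_pos hK r).ne', ← eta_mul_two_zpow (d := d) hK, mul_right_comm, eta_eq hK,
    Real.mul_self_sqrt (by positivity)]
  field_simp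

theorem epochScale_succ (K : ℕ) (r : ℤ) :
    epochScale K (r + 1) = Real.sqrt 2 * epochScale K r := by
  rw [epochScale, epochScale, ← Real.sqrt_mul (by norm_num), zpow_add_one₀ (by norm_num)]
  ring_nf

/-- The scales grow by √2 ≥ 1.4 per restart, so a potential of four times the scale can pay, at each
restart, for the (ln K)/η of the new epoch (first part) or for the accumulated η Q of the old one
(second part). -/
theorem four_mul_epochScale_succ (K : ℕ) (r : ℤ) :
    4 * epochScale K r + epochScale K (r + 1) ≤ 4 * epochScale K (r + 1) ∧
      5 * epochScale K r ≤ 4 * epochScale K (r + 1) := by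
  rw [epochScale_succ]
  have h : (1.4 : ℝ) ≤ Real.sqrt 2 := Real.le_sqrt_of_sq_le (by norm_num)
  have h0 := epochScale_nonneg K r
  constructor <;> nlinarith

/-! ### One round of the local algorithm -/

section Run

variable {N K : ℕ} (G : SimpleGraph (Fin N)) (d : ℕ) (l : ℕ → Fin K → ℝ)

/-- The indicator `B(i,v)` for the round `d` rounds before the last one of the history. -/
def delayedB (x : History N K) (v : Fin N) (i : Fin K) : ℝ :=
  match x.drop d with
  | [] => 0
  | b :: _ => B G d b i v

/-- The estimate computed by an active agent at the end of the last round of the history. -/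
def delayedEstimate (x : History N K) (v : Fin N) (i : Fin K) : ℝ :=
  l (x.length - d) i / q G d (prob G d l (x.drop (d + 1))) i v * delayedB G d x v i

/-- The quantity `Q` of an active agent at the end of the last round of the history. -/
def delayedQ (x : History N K) (v : Fin N) : ℝ :=
  Qterm G d (prob G d l (x.drop (d + 1))) v

theorem age_le_length (h : History N K) (v : Fin N) : (state G d l h v).age ≤ h.length := by
  induction h with
  | nil => simp [state, AgentState.start]
  | cons a h ih =>
    have key : ∀ e Q, ((state G d l h v).next d e Q).age ≤ h.length + 1 := by
      intro e Q
      unfold AgentState.next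
      split_ifs
      · simp [AgentState.start]
      · simpa using ih
    rw [state]
    split
    · exact key _ _
    · dsimp only
      split_ifs
      · exact key _ _
      · exact key _ _

/-- The age never exceeds the number of rounds played, so for an active agent the delayed round
exists and the empty branch of `state` is impossible. -/
theorem state_cons_of_le {h : History N K} {v : Fin N} (hd : d ≤ (state G d l h v).age)
    (a : Profile N K) :
    state G d l (a :: h) v = (state G d l h v).next d (delayedEstimate G d l (a :: h) v)
      (delayedQ G d l (a :: h) v) := by
  have hlen := age_le_length G d l h v
  rw [state]
  split
  next hnil =>
    rw [List.drop_eq_nil_iff, List.length_cons] at hnil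
    omega
  next b past hb =>
    have h1 : h.drop d = past := by
      have := congrArg List.tail hb
      simpa [List.tail_drop] using this
    have h2 : past.length + 1 = (a :: h).length - d := by
      have := congrArg List.length hb
      simpa using this.symm
    dsimp only
    rw [if_pos (by omega)]
    congr 1
    · funext i
      unfold delayedEstimate delayedB
      rw [hb, ← h2, List.drop_succ_cons, h1]
      rfl
    · unfold delayedQ
      rw [List.drop_succ_cons, h1]
      rfl

theorem state_cons_of_lt {h : History N K} {v : Fin N} (hd : (state G d l h v).age < d)
    (a : Profile N K) :
    state G d l (a :: h) v = (state G d l h v).next d (fun _ => 0) 0 := by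
  rw [state]
  split
  · rfl
  · dsimp only
    rw [if_neg (by omega)]

/-- The state of an agent depends only on the rounds before the last `d` ones. -/
theorem state_eq_of_drop_eq {h h' : History N K} (hl : h.length = h'.length)
    (hd : h.drop d = h'.drop d) : state G d l h = state G d l h' := by
  induction h generalizing h' with
  | nil =>
    rw [List.length_nil] at hl
    rw [List.length_eq_zero_iff.1 hl.symm]
  | cons a h ih =>
    rcases h' with _ | ⟨a', h'⟩
    · simp at hl
    have hl' : h.length = h'.length := by simpa using hl
    have hd' : h.drop d = h'.drop d := by
      have := congrArg List.tail hd
      simpa [List.tail_drop] using this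
    have hs := ih hl' hd'
    funext v
    by_cases hv : d ≤ (state G d l h v).age
    · rw [state_cons_of_le G d l hv, state_cons_of_le G d l (hs ▸ hv), hs]
      congr 1
      · funext i
        unfold delayedEstimate delayedB
        rw [hd, List.drop_succ_cons, List.drop_succ_cons, hd', hl]
      · unfold delayedQ
        rw [List.drop_succ_cons, List.drop_succ_cons, hd']
    · push Not at hv
      rw [state_cons_of_lt G d l hv, state_cons_of_lt G d l (hs ▸ hv), hs]

/-- At the end of a round the agent restarts or updates its weights. -/
theorem state_cons_cases (h : History N K) (a : Profile N K) (v : Fin N) :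
    ∃ (e : Fin K → ℝ) (Q : ℝ),
      (d ≤ (state G d l h v).age ∧ e = delayedEstimate G d l (a :: h) v ∧
          Q = delayedQ G d l (a :: h) v ∨
        (state G d l h v).age < d ∧ e = (fun _ => 0) ∧ Q = 0) ∧
      ((2 : ℝ) ^ (state G d l h v).r < (state G d l h v).acc + Q ∧
          state G d l (a :: h) v = AgentState.start K ((state G d l h v).r + 1) ∨
        (state G d l h v).acc + Q ≤ (2 : ℝ) ^ (state G d l h v).r ∧
          state G d l (a :: h) v =
            { w := fun i => (state G d l h v).p i *
                Real.exp (-(eta K d (state G d l h v).r) * e i)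
              r := (state G d l h v).r
              age := (state G d l h v).age + 1
              acc := (state G d l h v).acc + Q }) := by
  have key : ∀ e Q, state G d l (a :: h) v = (state G d l h v).next d e Q →
      ((2 : ℝ) ^ (state G d l h v).r < (state G d l h v).acc + Q ∧
          state G d l (a :: h) v = AgentState.start K ((state G d l h v).r + 1) ∨
        (state G d l h v).acc + Q ≤ (2 : ℝ) ^ (state G d l h v).r ∧
          state G d l (a :: h) v =
            { w := fun i => (state G d l h v).p i *
                Real.exp (-(eta K d (state G d l h v).r) * e i)
              r := (state G d l h v).r
              age := (state G d l h v).age + 1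
              acc := (state G d l h v).acc + Q }) := by
    intro e Q he
    rw [he]
    unfold AgentState.next
    split_ifs with hlt
    · exact Or.inl ⟨hlt, rfl⟩
    · exact Or.inr ⟨not_lt.1 hlt, rfl⟩
  rcases le_or_gt d (state G d l h v).age with hv | hv
  · exact ⟨_, _, Or.inl ⟨hv, rfl, rfl⟩, key _ _ (state_cons_of_le G d l hv a)⟩
  · exact ⟨_, _, Or.inr ⟨hv, rfl, rfl⟩, key _ _ (state_cons_of_lt G d l hv a)⟩

variable (hK : 2 ≤ K) (hl : ∀ t i, l t i ∈ Set.Icc (0 : ℝ) 1)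

theorem prob_le_one (hK : 2 ≤ K) (h : History N K) (v : Fin N) (i : Fin K) :
    prob G d l h v i ≤ 1 := by
  rw [← sum_prob (by omega) G d l h v]
  exact Finset.single_le_sum (fun j _ => (prob_pos G d l h v j).le) (Finset.mem_univ i)

theorem prob_le_q (hK : 2 ≤ K) (h : History N K) (v : Fin N) (i : Fin K) :
    prob G d l h v i ≤ q G d (prob G d l h) i v :=
  le_q G d (fun v => (prob_pos G d l h v i).le) (fun v => prob_le_one G d l hK h v i) v

theorem q_pos (hK : 2 ≤ K) (h : History N K) (v : Fin N) (i : Fin K) :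
    0 < q G d (prob G d l h) i v :=
  (prob_pos G d l h v i).trans_le (prob_le_q G d l hK h v i)

theorem B_nonneg (b : Profile N K) (v : Fin N) (i : Fin K) : 0 ≤ B G d b i v := by
  unfold B; split_ifs <;> norm_num

theorem B_le_one (b : Profile N K) (v : Fin N) (i : Fin K) : B G d b i v ≤ 1 := by
  unfold B; split_ifs <;> norm_num

theorem delayedB_nonneg (x : History N K) (v : Fin N) (i : Fin K) : 0 ≤ delayedB G d x v i := by
  unfold delayedB
  split
  · exact le_rfl
  · exact B_nonneg G d _ v i

theorem delayedB_le_one (x : History N K) (v : Fin N) (i : Fin K) : delayedB G d x v i ≤ 1 := by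
  unfold delayedB
  split
  · exact zero_le_one
  · exact B_le_one G d _ v i

theorem delayedB_sq (x : History N K) (v : Fin N) (i : Fin K) :
    delayedB G d x v i ^ 2 = delayedB G d x v i := by
  unfold delayedB
  split
  · norm_num
  · unfold B; split_ifs <;> norm_num

include hK hl in
theorem delayedEstimate_nonneg (x : History N K) (v : Fin N) (i : Fin K) :
    0 ≤ delayedEstimate G d l x v i :=
  mul_nonneg (div_nonneg (hl _ _).1 (q_pos G d l hK _ v i).le) (delayedB_nonneg G d x v i)

include hK in
theorem delayedQ_nonneg (x : History N K) (v : Fin N) : 0 ≤ delayedQ G d l x v :=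
  Qterm_nonneg G d (fun v i => prob_pos G d l _ v i) (fun v => sum_prob (by omega) G d l _ v) v

include hK in
theorem delayedQ_le (x : History N K) (v : Fin N) : delayedQ G d l x v ≤ d + 2 * K :=
  Qterm_le G d (fun v i => prob_pos G d l _ v i) (fun v => sum_prob (by omega) G d l _ v) v

include hK hl in
theorem prob_mul_delayedEstimate_le (x : History N K) (v : Fin N) (i : Fin K) :
    prob G d l (x.drop (d + 1)) v i * delayedEstimate G d l x v i ≤ 1 := by
  have hq := q_pos G d l hK (x.drop (d + 1)) v i
  have hpq := prob_le_q G d l hK (x.drop (d + 1)) v i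
  have hp := prob_pos G d l (x.drop (d + 1)) v i
  have h1 : delayedEstimate G d l x v i ≤ 1 / q G d (prob G d l (x.drop (d + 1))) i v := by
    unfold delayedEstimate
    have h2 : l (x.length - d) i / q G d (prob G d l (x.drop (d + 1))) i v ≤
        1 / q G d (prob G d l (x.drop (d + 1))) i v :=
      div_le_div_of_nonneg_right (hl _ _).2 hq.le
    refine (mul_le_mul h2 (delayedB_le_one G d x v i) (delayedB_nonneg G d x v i)
      (by positivity)).trans_eq (mul_one _)
  calc _ ≤ prob G d l (x.drop (d + 1)) v i * (1 / q G d (prob G d l (x.drop (d + 1))) i v) :=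
        mul_le_mul_of_nonneg_left h1 hp.le
    _ ≤ 1 := by rw [mul_one_div, div_le_one hq]; exact hpq

/-! ### Invariants -/

theorem r0_le_r (h : History N K) (v : Fin N) : r0 K d ≤ (state G d l h v).r := by
  induction h with
  | nil => simp [state, AgentState.start]
  | cons a h ih =>
    obtain ⟨e, Q, -, ⟨-, hs⟩ | ⟨-, hs⟩⟩ := state_cons_cases G d l h a v
    · rw [hs]; simp only [AgentState.start]; omega
    · rw [hs]; exact ih

theorem acc_le (h : History N K) (v : Fin N) :
    (state G d l h v).acc ≤ (2 : ℝ) ^ (state G d l h v).r := by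
  cases h with
  | nil => simp only [state, AgentState.start]; positivity
  | cons a h =>
    obtain ⟨e, Q, -, ⟨-, hs⟩ | ⟨hle, hs⟩⟩ := state_cons_cases G d l h a v
    · rw [hs]; simp only [AgentState.start]; positivity
    · rw [hs]; exact hle

include hK in
theorem acc_nonneg (h : History N K) (v : Fin N) : 0 ≤ (state G d l h v).acc := by
  induction h with
  | nil => simp [state, AgentState.start]
  | cons a h ih =>
    obtain ⟨e, Q, hQ, ⟨-, hs⟩ | ⟨hle, hs⟩⟩ := state_cons_cases G d l h a v
    · rw [hs]; simp [AgentState.start]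
    · rw [hs]
      refine add_nonneg ih ?_
      rcases hQ with ⟨-, -, rfl⟩ | ⟨-, -, rfl⟩
      · exact delayedQ_nonneg G d l hK _ v
      · exact le_rfl

theorem prob_cons_of_update {h : History N K} {a : Profile N K} {v : Fin N} {e : Fin K → ℝ}
    {r : ℤ} {n : ℕ} {A : ℝ}
    (hs : state G d l (a :: h) v =
      { w := fun i => (state G d l h v).p i * Real.exp (-(eta K d (state G d l h v).r) * e i)
        r := r, age := n, acc := A }) (i : Fin K) :
    prob G d l (a :: h) v i =
      prob G d l h v i * Real.exp (-(eta K d (state G d l h v).r) * e i) /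
        ∑ j, prob G d l h v j * Real.exp (-(eta K d (state G d l h v).r) * e j) := by
  rw [prob, hs]
  rfl

theorem prob_of_start {h : History N K} {v : Fin N} {r : ℤ}
    (hs : state G d l h v = AgentState.start K r) (i : Fin K) :
    prob G d l h v i = 1 / K := by
  rw [prob, hs]
  simp [AgentState.start, AgentState.p]

theorem one_add_inv_pow_le_exp (d : ℕ) : (1 + 1 / (d : ℝ)) ^ d ≤ Real.exp 1 := by
  rcases Nat.eq_zero_or_pos d with rfl | hd
  · simp
  · have hd' : (0 : ℝ) < d := by exact_mod_cast hd
    have h1 : 1 + 1 / (d : ℝ) ≤ Real.exp (1 / d) := by linarith [Real.add_one_le_exp (1 / (d : ℝ))]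
    calc (1 + 1 / (d : ℝ)) ^ d ≤ Real.exp (1 / d) ^ d := by gcongr
      _ = Real.exp 1 := by rw [← Real.exp_nat_mul]; congr 1; field_simp

include hK hl in
/-- The probabilities grow slowly within an epoch. -/
theorem prob_le_pow_mul (h : History N K) (v : Fin N) {k : ℕ} (hk : k ≤ d)
    (hage : k ≤ (state G d l h v).age) (i : Fin K) :
    prob G d l h v i ≤ (1 + 1 / (d : ℝ)) ^ k * prob G d l (h.drop k) v i := by
  induction h generalizing k i with
  | nil =>
    have : k = 0 := by simpa [state, AgentState.start] using hage
    subst this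
    simp
  | cons a h ih =>
    rcases k with _ | k
    · simp
    obtain ⟨e, Q, hQ, ⟨-, hs⟩ | ⟨-, hs⟩⟩ := state_cons_cases G d l h a v
    · rw [hs] at hage; simp [AgentState.start] at hage
    have hage' : k ≤ (state G d l h v).age := by
      rw [hs] at hage
      exact Nat.le_of_succ_le_succ hage
    have hd0 : (0 : ℝ) < d := by exact_mod_cast (by omega : 0 < d)
    have hη := eta_pos (d := d) hK (state G d l h v).r
    have he : ∀ j, 0 ≤ e j := by
      rcases hQ with ⟨-, rfl, -⟩ | ⟨-, rfl, -⟩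
      · exact delayedEstimate_nonneg G d l hK hl _ v
      · exact fun _ => le_rfl
    have hpe : ∑ j, prob G d l h v j * e j ≤ K * Real.exp 1 := by
      rcases hQ with ⟨hact, rfl, -⟩ | ⟨-, rfl, -⟩
      · calc ∑ j, prob G d l h v j * delayedEstimate G d l (a :: h) v j
            ≤ ∑ j : Fin K, Real.exp 1 := by
              refine Finset.sum_le_sum fun j _ => ?_
              -- The induction hypothesis is used with the full delay `d`, not just `k`: the growth
              -- bound up to now controls the estimate that drives the next update.
              have h1 := ih le_rfl hact j
              have h2 := prob_mul_delayedEstimate_le G d l hK hl (a :: h) v j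
              have h3 := he j
              have h4 : prob G d l h v j ≤ Real.exp 1 * prob G d l (h.drop d) v j :=
                h1.trans (mul_le_mul_of_nonneg_right (one_add_inv_pow_le_exp d)
                  (prob_pos G d l _ v j).le)
              rw [List.drop_succ_cons] at h2
              nlinarith [mul_le_mul_of_nonneg_right h4 h3, Real.exp_pos 1]
          _ = K * Real.exp 1 := by simp
      · simp only [mul_zero, Finset.sum_const_zero]
        positivity
    have hstep : eta K d (state G d l h v).r * ∑ j, prob G d l h v j * e j ≤ 1 / (d + 1) :=
      (mul_le_mul_of_nonneg_left hpe hη.le).trans (eta_mul_le hK (r0_le_r G d l h v))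
    -- The growth factor of one update is the reciprocal of 1 - 1/(d+1), that is 1 + 1/d.
    have hc : 1 ≤ (1 + 1 / (d : ℝ)) *
        (1 - eta K d (state G d l h v).r * ∑ j, prob G d l h v j * e j) := by
      have h5 : (1 + 1 / (d : ℝ)) * (1 - 1 / (d + 1)) = 1 := by field_simp; ring
      exact h5.symm.le.trans (mul_le_mul_of_nonneg_left (by linarith) (by positivity))
    have h6 := expUpdate_le (fun j => prob_pos G d l h v j) (sum_prob (by omega) G d l h v) he hη
      hc (by positivity) i
    rw [prob_cons_of_update G d l hs, List.drop_succ_cons, pow_succ']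
    refine h6.trans ?_
    rw [mul_assoc]
    exact mul_le_mul_of_nonneg_left (ih (by omega) hage' i) (by positivity)

include hK hl in
theorem prob_le_exp_one_mul {h : History N K} {v : Fin N} (hage : d ≤ (state G d l h v).age)
    (i : Fin K) : prob G d l h v i ≤ Real.exp 1 * prob G d l (h.drop d) v i :=
  (prob_le_pow_mul G d l hK hl h v le_rfl hage i).trans
    (mul_le_mul_of_nonneg_right (one_add_inv_pow_le_exp d) (prob_pos G d l _ v i).le)

end Run

/-! ### Expectations -/

section Expect

variable {N K : ℕ} (G : SimpleGraph (Fin N)) (d : ℕ) (l : ℕ → Fin K → ℝ)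

theorem expect_mono {T : ℕ} {f g : History N K → ℝ} (h : ∀ x, x.length = T → f x ≤ g x) :
    expect G d l T f ≤ expect G d l T g := by
  induction T generalizing f g with
  | zero => exact h [] rfl
  | succ T ih =>
    refine ih fun x hx => Finset.sum_le_sum fun a _ => ?_
    exact mul_le_mul_of_nonneg_left (h _ (by simp [hx]))
      (Finset.prod_nonneg fun v _ => (prob_pos G d l x v _).le)

theorem expect_congr {T : ℕ} {f g : History N K → ℝ} (h : ∀ x, x.length = T → f x = g x) :
    expect G d l T f = expect G d l T g :=
  le_antisymm (expect_mono G d l fun x hx => (h x hx).le)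
    (expect_mono G d l fun x hx => (h x hx).ge)

theorem expect_add (T : ℕ) (f g : History N K → ℝ) :
    expect G d l T (fun x => f x + g x) = expect G d l T f + expect G d l T g := by
  induction T generalizing f g with
  | zero => rfl
  | succ T ih =>
    simp only [expect, mul_add, Finset.sum_add_distrib]
    exact ih _ _

theorem expect_const_mul (T : ℕ) (c : ℝ) (f : History N K → ℝ) :
    expect G d l T (fun x => c * f x) = c * expect G d l T f := by
  induction T generalizing f with
  | zero => rfl
  | succ T ih =>
    simp only [expect]
    rw [← ih]
    refine expect_congr G d l fun x _ => ?_
    rw [Finset.mul_sum]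
    exact Finset.sum_congr rfl fun a _ => by ring

theorem expect_sub (T : ℕ) (f g : History N K → ℝ) :
    expect G d l T (fun x => f x - g x) = expect G d l T f - expect G d l T g := by
  have h1 := expect_add G d l T f fun x => -1 * g x
  rw [expect_const_mul] at h1
  simp only [neg_mul, one_mul, ← sub_eq_add_neg] at h1
  exact h1

theorem expect_sum {ι : Type*} (hK : 0 < K) (T : ℕ) (s : Finset ι) (f : ι → History N K → ℝ) :
    expect G d l T (fun x => ∑ i ∈ s, f i x) = ∑ i ∈ s, expect G d l T (f i) := by
  classical
  induction s using Finset.induction_on with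
  | empty => simpa using expect_const hK G d l T 0
  | insert i s hi ih => simp only [Finset.sum_insert hi, expect_add, ih]

theorem expect_nonneg (hK : 0 < K) {T : ℕ} {f : History N K → ℝ}
    (h : ∀ x, x.length = T → 0 ≤ f x) : 0 ≤ expect G d l T f := by
  rw [← expect_const hK G d l T 0]
  exact expect_mono G d l h

theorem sum_prod_mul_prod (h : History N K) (f : Fin N → Fin K → ℝ) :
    ∑ a : Profile N K, (∏ v, prob G d l h v (a v)) * ∏ v, f v (a v) =
      ∏ v, ∑ i, prob G d l h v i * f v i := by
  have := Finset.prod_univ_sum (fun _ : Fin N => (Finset.univ : Finset (Fin K)))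
    (fun v i => prob G d l h v i * f v i)
  simp only [Fintype.piFinset_univ] at this
  rw [this]
  simp only [Finset.prod_mul_distrib]

theorem sum_prod_prob (hK : 0 < K) (h : History N K) :
    ∑ a : Profile N K, ∏ v, prob G d l h v (a v) = 1 := by
  have := sum_prod_mul_prod G d l h fun _ _ => 1
  simpa [sum_prob hK] using this

theorem sum_prod_mul_apply (hK : 0 < K) (h : History N K) (v : Fin N) (f : Fin K → ℝ) :
    ∑ a : Profile N K, (∏ u, prob G d l h u (a u)) * f (a v) =
      ∑ i, prob G d l h v i * f i := by
  classical
  have := sum_prod_mul_prod G d l h fun u i => if u = v then f i else 1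
  simp only [Finset.prod_ite_eq', Finset.mem_univ, if_true] at this
  rw [this, Finset.prod_eq_single v]
  · simp
  · intro u _ hu
    simp [hu, sum_prob hK]
  · simp

/-- The complement of the event is an intersection over the agents of the ball, so its indicator is
a product and its mean factorises by independence. -/
theorem sum_prod_mul_B (hK : 0 < K) (h : History N K) (v : Fin N) (i : Fin K) :
    ∑ a : Profile N K, (∏ u, prob G d l h u (a u)) * B G d a i v =
      q G d (prob G d l h) i v := by
  classical
  have hB : ∀ a : Profile N K, B G d a i v =
      1 - ∏ u, if u ∈ ball G d v ∧ a u = i then (0 : ℝ) else 1 := by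
    intro a
    unfold B
    split_ifs with hex
    · obtain ⟨u, hu, hau⟩ := hex
      rw [Finset.prod_eq_zero (Finset.mem_univ u) (by simp [hu, hau])]
      simp
    · push Not at hex
      rw [Finset.prod_eq_one, sub_self]
      intro u _
      rw [if_neg]
      exact fun hu => hex u hu.1 hu.2
  have hprod := sum_prod_mul_prod G d l h
    fun u j => if u ∈ ball G d v ∧ j = i then (0 : ℝ) else 1
  simp only [hB, mul_sub, mul_one, Finset.sum_sub_distrib, sum_prod_prob G d l hK, hprod]
  rw [q]
  congr 1
  rw [← Finset.prod_subset (Finset.subset_univ (ball G d v))]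
  · refine Finset.prod_congr rfl fun u hu => ?_
    have h1 : ∀ j, prob G d l h u j * (if u ∈ ball G d v ∧ j = i then (0 : ℝ) else 1) =
        prob G d l h u j - if j = i then prob G d l h u j else 0 := by
      intro j
      by_cases hj : j = i <;> simp [hj, hu]
    simp only [h1, Finset.sum_sub_distrib, sum_prob hK]
    simp
  · intro u _ hu
    simp [hu, sum_prob hK]

theorem expect_tail (hK : 0 < K) (T : ℕ) (f : History N K → ℝ) :
    expect G d l (T + 1) (fun x => f x.tail) = expect G d l T f := by
  rw [expect]
  refine expect_congr G d l fun x _ => ?_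
  simp only [List.tail_cons, ← Finset.sum_mul, sum_prod_prob G d l hK, one_mul]

theorem expect_drop (hK : 0 < K) (T k : ℕ) (f : History N K → ℝ) :
    expect G d l (T + k) (fun x => f (x.drop k)) = expect G d l T f := by
  induction k with
  | zero => simp
  | succ k ih =>
    rw [← ih, ← expect_tail G d l hK (T + k), ← add_assoc]
    refine expect_congr G d l fun x _ => ?_
    rw [← List.drop_one, List.drop_drop, add_comm]

/-- Functions of the rounds before the last `k` ones. -/
def DependsOnDrop (k : ℕ) (c : History N K → ℝ) : Prop :=
  ∀ x y : History N K, x.length = y.length → x.drop k = y.drop k → c x = c y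

/-- Given the rounds before it, the indicator `B` has mean `q`. -/
theorem expect_mul_delayedB (hK : 0 < K) {T : ℕ} (hT : d < T) {c : History N K → ℝ}
    (hc : DependsOnDrop (d + 1) c) (v : Fin N) (i : Fin K) :
    expect G d l T (fun x => c x * delayedB G d x v i) =
      expect G d l T (fun x => c x * q G d (prob G d l (x.drop (d + 1))) i v) := by
  obtain ⟨m, rfl⟩ : ∃ m, T = m + (d + 1) := ⟨T - (d + 1), by omega⟩
  -- To view `c` as a function of the older rounds alone, the last d + 1 rounds are replaced by
  -- arbitrary constant profiles.
  set c' : History N K → ℝ := fun past => c (List.replicate (d + 1) (fun _ => ⟨0, hK⟩) ++ past)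
    with hc'
  have hcc : ∀ x : History N K, x.length = m + (d + 1) → c x = c' (x.drop (d + 1)) := by
    intro x hx
    refine hc _ _ ?_ ?_
    · simp only [List.length_append, List.length_replicate, List.length_drop, hx]
      omega
    · rw [List.drop_left' (by simp)]
  obtain ⟨g, hg⟩ : ∃ g : History N K → ℝ, g = fun y => c' y.tail *
      (match y with | [] => 0 | b :: _ => B G d b i v) := ⟨_, rfl⟩
  have h1 : expect G d l (m + (d + 1)) (fun x => c x * delayedB G d x v i) =
      expect G d l (m + 1 + d) (fun x => g (x.drop d)) := by
    rw [show m + (d + 1) = m + 1 + d by ring]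
    refine expect_congr G d l fun x hx => ?_
    rw [hcc x (by omega), hg, ← List.tail_drop]
    rfl
  have h2 : expect G d l (m + (d + 1))
      (fun x => c x * q G d (prob G d l (x.drop (d + 1))) i v) =
      expect G d l m (fun y => c' y * q G d (prob G d l y) i v) := by
    rw [← expect_drop G d l hK m (d + 1)]
    exact expect_congr G d l fun x hx => by rw [hcc x hx]
  rw [h1, h2, expect_drop G d l hK, hg, expect]
  refine expect_congr G d l fun x _ => ?_
  rw [← sum_prod_mul_B G d l hK, Finset.mul_sum]
  exact Finset.sum_congr rfl fun a _ => by simp only [List.tail_cons]; ring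

theorem expect_cumLoss (hK : 0 < K) (T : ℕ) (v : Fin N) :
    expect G d l T (cumLoss l v) =
      ∑ t ∈ Finset.range T, expect G d l t fun h => ∑ i, prob G d l h v i * l (t + 1) i := by
  induction T with
  | zero => rfl
  | succ T ih =>
    rw [Finset.sum_range_succ, ← ih, ← expect_add, expect]
    refine expect_congr G d l fun x hx => ?_
    simp only [cumLoss, mul_add, Finset.sum_add_distrib, ← Finset.sum_mul,
      sum_prod_prob G d l hK, one_mul, hx]
    rw [sum_prod_mul_apply G d l hK x v (l (T + 1))]

/-- Telescoping of a potential. -/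
theorem sum_expect_le_of_potential (hK : 0 < K) (T : ℕ) (Y Φ : History N K → ℝ)
    (h : ∀ a x, Y (a :: x) ≤ Φ (a :: x) - Φ x) :
    ∑ t ∈ Finset.range T, expect G d l (t + 1) Y ≤ expect G d l T Φ - Φ [] := by
  induction T with
  | zero => simp [expect]
  | succ T ih =>
    rw [Finset.sum_range_succ]
    have h1 : expect G d l (T + 1) Y ≤ expect G d l (T + 1) (fun x => Φ x - Φ x.tail) := by
      refine expect_mono G d l fun x hx => ?_
      rcases x with _ | ⟨a, x⟩
      · simp at hx
      · exact h a x
    rw [expect_sub, expect_tail G d l hK] at h1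
    linarith

end Expect

/-! ### Updates and learning rates along a history -/

section Run

variable {N K : ℕ} (G : SimpleGraph (Fin N)) (d : ℕ) (l : ℕ → Fin K → ℝ)

/-- The indicator that in the last round of the history the agent was active and did not
restart. -/
def updated (x : History N K) (v : Fin N) : ℝ := if d < (state G d l x v).age then 1 else 0

/-- The learning rate of the agent after the history. -/
def rate (x : History N K) (v : Fin N) : ℝ := eta K d (state G d l x v).r

theorem updated_nonneg (x : History N K) (v : Fin N) : 0 ≤ updated G d l x v := by
  unfold updated; split_ifs <;> norm_num

theorem updated_le_one (x : History N K) (v : Fin N) : updated G d l x v ≤ 1 := by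
  unfold updated; split_ifs <;> norm_num

theorem updated_eq_zero_of_length_le {x : History N K} (hx : x.length ≤ d) (v : Fin N) :
    updated G d l x v = 0 :=
  if_neg (by have := age_le_length G d l x v; omega)

/-! ### What the quantities depend on -/

theorem state_tail_eq {x y : History N K} (hl : x.length = y.length)
    (hd : x.drop (d + 1) = y.drop (d + 1)) : state G d l x.tail = state G d l y.tail := by
  refine state_eq_of_drop_eq G d l (by simp [hl]) ?_
  rwa [← List.drop_one, ← List.drop_one, List.drop_drop, List.drop_drop, add_comm 1 d]

/-- The actions of round t - d enter the step at the end of round t only through the estimates,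
which affect the weights alone; `r` and `age` react only to Q. They are thus determined one round
earlier than the full state, which makes `updated` and `rate` admissible multipliers in the
unbiasedness identities. -/
theorem r_age_eq {x y : History N K} (hl : x.length = y.length)
    (hd : x.drop (d + 1) = y.drop (d + 1)) (v : Fin N) :
    (state G d l x v).r = (state G d l y v).r ∧
      (state G d l x v).age = (state G d l y v).age := by
  have hs := state_tail_eq G d l hl hd
  rcases x with _ | ⟨a, x⟩
  · rw [List.length_nil] at hl
    rw [List.length_eq_zero_iff.1 hl.symm]
    exact ⟨rfl, rfl⟩
  rcases y with _ | ⟨b, y⟩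
  · simp at hl
  rw [List.tail_cons, List.tail_cons] at hs
  have hQ : delayedQ G d l (a :: x) v = delayedQ G d l (b :: y) v := by
    unfold delayedQ
    rw [hd]
  have key : ∀ (s : AgentState K) e e' Q, (s.next d e Q).r = (s.next d e' Q).r ∧
      (s.next d e Q).age = (s.next d e' Q).age := by
    intro s e e' Q
    unfold AgentState.next
    split_ifs
    · exact ⟨rfl, rfl⟩
    · exact ⟨rfl, rfl⟩
  by_cases hv : d ≤ (state G d l x v).age
  · rw [state_cons_of_le G d l hv, state_cons_of_le G d l (hs ▸ hv), hs, hQ]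
    exact key _ _ _ _
  · push Not at hv
    rw [state_cons_of_lt G d l hv, state_cons_of_lt G d l (hs ▸ hv), hs]
    exact ⟨rfl, rfl⟩

theorem dependsOnDrop_updated (v : Fin N) :
    DependsOnDrop (d + 1) fun x : History N K => updated G d l x v := fun x y hl hd => by
  simp only [updated, (r_age_eq G d l hl hd v).2]

theorem dependsOnDrop_rate (v : Fin N) :
    DependsOnDrop (d + 1) fun x : History N K => rate G d l x v := fun x y hl hd => by
  simp only [rate, (r_age_eq G d l hl hd v).1]

theorem dependsOnDrop_prob_tail (v : Fin N) (i : Fin K) :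
    DependsOnDrop (d + 1) fun x : History N K => prob G d l x.tail v i := fun x y hl hd => by
  simp only [prob, state_tail_eq G d l hl hd]

theorem DependsOnDrop.mul {k : ℕ} {f g : History N K → ℝ} (hf : DependsOnDrop k f)
    (hg : DependsOnDrop k g) : DependsOnDrop k fun x => f x * g x :=
  fun x y hl hd => by simp only [hf x y hl hd, hg x y hl hd]

theorem dependsOnDrop_const (k : ℕ) (c : ℝ) : DependsOnDrop k fun _ : History N K => c :=
  fun _ _ _ _ => rfl

variable (hK : 2 ≤ K) (hl : ∀ t i, l t i ∈ Set.Icc (0 : ℝ) 1)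

include hK in
/-- The estimates are unbiased. -/
theorem expect_mul_delayedEstimate {T : ℕ} (hT : d < T) {c : History N K → ℝ}
    (hc : DependsOnDrop (d + 1) c) (v : Fin N) (i : Fin K) :
    expect G d l T (fun x => c x * delayedEstimate G d l x v i) =
      expect G d l T (fun x => c x * l (T - d) i) := by
  have h1 := expect_mul_delayedB G d l (by omega) hT (c := fun x => c x *
    (l (x.length - d) i / q G d (prob G d l (x.drop (d + 1))) i v))
    (fun x y hl hd => by simp only [hc x y hl hd, hl, hd]) v i
  have h2 : expect G d l T (fun x => c x * delayedEstimate G d l x v i) = _ :=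
    (expect_congr G d l fun x _ => by rw [delayedEstimate, mul_assoc]).trans h1
  rw [h2]
  refine expect_congr G d l fun x hx => ?_
  have hq := q_pos G d l hK (x.drop (d + 1)) v i
  rw [hx, mul_assoc, div_mul_cancel₀ _ hq.ne']

include hK in
/-- The second moments of the estimates. -/
theorem expect_mul_delayedEstimate_sq {T : ℕ} (hT : d < T) {c : History N K → ℝ}
    (hc : DependsOnDrop (d + 1) c) (v : Fin N) (i : Fin K) :
    expect G d l T (fun x => c x * delayedEstimate G d l x v i ^ 2) =
      expect G d l T (fun x => c x *
        (l (T - d) i ^ 2 / q G d (prob G d l (x.drop (d + 1))) i v)) := by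
  have h1 := expect_mul_delayedB G d l (by omega) hT (c := fun x => c x *
    (l (x.length - d) i / q G d (prob G d l (x.drop (d + 1))) i v) ^ 2)
    (fun x y hl hd => by simp only [hc x y hl hd, hl, hd]) v i
  have h2 : expect G d l T (fun x => c x * delayedEstimate G d l x v i ^ 2) = _ :=
    (expect_congr G d l fun x _ => by
      rw [delayedEstimate, mul_pow, delayedB_sq, mul_assoc]).trans h1
  rw [h2]
  refine expect_congr G d l fun x hx => ?_
  have hq := q_pos G d l hK (x.drop (d + 1)) v i
  rw [hx]
  field_simp

/-! ### Potentials -/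

/-- The number of rounds without an update. -/
theorem one_sub_updated_le (a : Profile N K) (h : History N K) (v : Fin N) :
    1 - updated G d l (a :: h) v ≤
      (((min (state G d l (a :: h) v).age d : ℕ) : ℝ)
        + (d + 1) * ((state G d l (a :: h) v).r : ℝ))
      - (((min (state G d l h v).age d : ℕ) : ℝ) + (d + 1) * ((state G d l h v).r : ℝ)) := by
  unfold updated
  obtain ⟨e, Q, -, ⟨-, hs⟩ | ⟨-, hs⟩⟩ := state_cons_cases G d l h a v
  -- At a restart the capped age drops by at most d while (d+1) r gains d + 1, which pays for the
  -- lost round.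
  · rw [hs]
    have : ((min (state G d l h v).age d : ℕ) : ℝ) ≤ d := by exact_mod_cast min_le_right _ _
    simp only [AgentState.start]
    push_cast
    simp
    push_cast at this
    linarith
  · rw [hs]
    dsimp only
    rcases le_or_gt d (state G d l h v).age with hd | hd
    · rw [min_eq_right hd, min_eq_right (by omega), if_pos (by omega)]
      simp
    · rw [min_eq_left hd.le, min_eq_left (by omega), if_neg (by omega)]
      push_cast
      linarith

include hK hl in
/-- The regret with respect to the estimates. -/
theorem updated_mul_regret_le (a : Profile N K) (h : History N K) (v : Fin N) (i : Fin K) :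
    updated G d l (a :: h) v *
        ((∑ j, prob G d l h v j * delayedEstimate G d l (a :: h) v j)
          - delayedEstimate G d l (a :: h) v i
          - rate G d l (a :: h) v / 2 *
            ∑ j, prob G d l h v j * delayedEstimate G d l (a :: h) v j ^ 2) ≤
      (4 * epochScale K (state G d l (a :: h) v).r
        + Real.log (prob G d l (a :: h) v i) / rate G d l (a :: h) v)
      - (4 * epochScale K (state G d l h v).r
        + Real.log (prob G d l h v i) / rate G d l h v) := by
  obtain ⟨e, Q, hQ, ⟨-, hs⟩ | ⟨-, hs⟩⟩ := state_cons_cases G d l h a v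
  · have hp := prob_of_start G d l hs i
    rw [hp, updated, rate, rate, hs]
    simp only [AgentState.start, Nat.not_lt_zero, if_false, zero_mul]
    have h1 : Real.log (prob G d l h v i) / eta K d (state G d l h v).r ≤ 0 :=
      div_nonpos_of_nonpos_of_nonneg
        (Real.log_nonpos (prob_pos G d l h v i).le (prob_le_one G d l hK h v i))
        (eta_pos hK _).le
    rw [one_div, Real.log_inv, neg_div, log_div_eta hK]
    have h2 := (four_mul_epochScale_succ K (state G d l h v).r).1
    linarith
  · have he : ∀ j, 0 ≤ e j := by
      rcases hQ with ⟨-, rfl, -⟩ | ⟨-, rfl, -⟩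
      · exact delayedEstimate_nonneg G d l hK hl _ v
      · exact fun _ => le_rfl
    have h1 := expUpdate_regret (fun j => prob_pos G d l h v j) (sum_prob (by omega) G d l h v) he
      (eta_pos (d := d) hK (state G d l h v).r) i
    rw [← prob_cons_of_update G d l hs] at h1
    rw [updated, rate, rate, hs]
    dsimp only
    rcases hQ with ⟨hd, rfl, -⟩ | ⟨hd, rfl, -⟩
    · rw [if_pos (by omega)]
      linarith
    · rw [if_neg (by omega)]
      simp only [mul_zero, Finset.sum_const_zero, ne_eq, OfNat.ofNat_ne_zero, not_false_eq_true,
        zero_pow] at h1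
      linarith

include hK in
/-- The sum of the `η Q`. -/
theorem updated_mul_rate_mul_delayedQ_le (a : Profile N K) (h : History N K) (v : Fin N) :
    updated G d l (a :: h) v * rate G d l (a :: h) v * delayedQ G d l (a :: h) v ≤
      (rate G d l (a :: h) v * (state G d l (a :: h) v).acc
        + 4 * epochScale K (state G d l (a :: h) v).r)
      - (rate G d l h v * (state G d l h v).acc + 4 * epochScale K (state G d l h v).r) := by
  obtain ⟨e, Q, hQ, ⟨-, hs⟩ | ⟨-, hs⟩⟩ := state_cons_cases G d l h a v
  · rw [updated, rate, rate, hs]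
    simp only [AgentState.start, Nat.not_lt_zero, if_false, zero_mul, mul_zero]
    have h1 := mul_le_mul_of_nonneg_left (acc_le G d l h v)
      (eta_pos (d := d) hK (state G d l h v).r).le
    rw [eta_mul_two_zpow hK] at h1
    have h2 := (four_mul_epochScale_succ K (state G d l h v).r).2
    linarith
  · rw [updated, rate, rate, hs]
    dsimp only
    rcases hQ with ⟨hd, -, rfl⟩ | ⟨hd, -, rfl⟩
    · rw [if_pos (by omega)]
      linarith
    · rw [if_neg (by omega)]
      linarith

include hK in
/-- The growth of `2^r`. -/
theorem two_zpow_add_acc_cons_le (a : Profile N K) (h : History N K) (v : Fin N) :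
    ((2 : ℝ) ^ (state G d l (a :: h) v).r + (state G d l (a :: h) v).acc)
      - ((2 : ℝ) ^ (state G d l h v).r + (state G d l h v).acc) ≤
      if d < (a :: h).length then delayedQ G d l (a :: h) v else 0 := by
  have hlen := age_le_length G d l h v
  have hif : ∀ Q, (∃ e : Fin K → ℝ,
      d ≤ (state G d l h v).age ∧ e = delayedEstimate G d l (a :: h) v ∧
          Q = delayedQ G d l (a :: h) v ∨
        (state G d l h v).age < d ∧ e = (fun _ => 0) ∧ Q = 0) →
      Q ≤ if d < (a :: h).length then delayedQ G d l (a :: h) v else 0 := by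
    rintro Q ⟨e, ⟨hd, -, rfl⟩ | ⟨hd, -, rfl⟩⟩
    · rw [if_pos (by rw [List.length_cons]; omega)]
    · split_ifs
      · exact delayedQ_nonneg G d l hK _ v
      · exact le_rfl
  obtain ⟨e, Q, hQ, ⟨hlt, hs⟩ | ⟨-, hs⟩⟩ := state_cons_cases G d l h a v
  -- At a restart the potential rises by 2^r - acc, which is below Q exactly because the restart
  -- test succeeded.
  · refine le_trans ?_ (hif Q ⟨e, hQ⟩)
    rw [hs]
    simp only [AgentState.start]
    rw [zpow_add_one₀ (by norm_num)]
    linarith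
  · refine le_trans ?_ (hif Q ⟨e, hQ⟩)
    rw [hs]
    dsimp only
    linarith

include hK hl in
/-- The drift of the probabilities within an epoch. -/
theorem prob_drop_sub_le (h : History N K) (v : Fin N) {k : ℕ}
    (hage : k ≤ (state G d l h v).age) (i : Fin K) :
    prob G d l (h.drop k) v i - prob G d l h v i ≤
      ∑ j ∈ Finset.range k, updated G d l (h.drop j) v * rate G d l (h.drop j) v *
        (prob G d l (h.drop j).tail v i * delayedEstimate G d l (h.drop j) v i) := by
  induction h generalizing k with
  | nil =>
    have : k = 0 := by simpa [state, AgentState.start] using hage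
    subst this
    simp
  | cons a h ih =>
    rcases k with _ | k
    · simp
    obtain ⟨e, Q, hQ, ⟨-, hs⟩ | ⟨-, hs⟩⟩ := state_cons_cases G d l h a v
    · rw [hs] at hage; simp [AgentState.start] at hage
    have hage' : k ≤ (state G d l h v).age := by
      rw [hs] at hage
      exact Nat.le_of_succ_le_succ hage
    have he : ∀ j, 0 ≤ e j := by
      rcases hQ with ⟨-, rfl, -⟩ | ⟨-, rfl, -⟩
      · exact delayedEstimate_nonneg G d l hK hl _ v
      · exact fun _ => le_rfl
    have h1 := sub_expUpdate_le (fun j => prob_pos G d l h v j) (sum_prob (by omega) G d l h v) he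
      (eta_pos (d := d) hK (state G d l h v).r) i
    rw [← prob_cons_of_update G d l hs] at h1
    rw [Finset.sum_range_succ']
    simp only [List.drop_succ_cons, List.drop_zero, List.tail_cons]
    have h2 : eta K d (state G d l h v).r * (prob G d l h v i * e i) =
        updated G d l (a :: h) v * rate G d l (a :: h) v *
          (prob G d l h v i * delayedEstimate G d l (a :: h) v i) := by
      rw [updated, rate, hs]
      dsimp only
      rcases hQ with ⟨hd, rfl, -⟩ | ⟨hd, rfl, -⟩
      · rw [if_pos (by omega), one_mul]
      · rw [if_neg (by omega)]
        ring
    have h3 := ih hage'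
    linarith

theorem le_age_of_lt_age_cons {h : History N K} {a : Profile N K} {v : Fin N}
    (hg : d < (state G d l (a :: h) v).age) : d ≤ (state G d l h v).age := by
  obtain ⟨e, Q, -, ⟨-, hs⟩ | ⟨-, hs⟩⟩ := state_cons_cases G d l h a v
  · rw [hs] at hg; simp [AgentState.start] at hg
  · rw [hs] at hg; exact Nat.le_of_lt_succ hg

end Run

section Run

variable {N K : ℕ} (G : SimpleGraph (Fin N)) (d : ℕ) (l : ℕ → Fin K → ℝ)
variable (hK : 2 ≤ K) (hl : ∀ t i, l t i ∈ Set.Icc (0 : ℝ) 1)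

/-! ### The regret of one round -/

theorem rate_pos (hK : 2 ≤ K) (x : History N K) (v : Fin N) : 0 < rate G d l x v := eta_pos hK _

/-- The contribution of action `j` to the drift of the probabilities in the last round. -/
def drift (v : Fin N) (j : Fin K) (y : History N K) : ℝ :=
  updated G d l y v * rate G d l y v * (prob G d l y.tail v j * delayedEstimate G d l y v j)

/-- The regret with respect to the estimates in the last round, minus its second-order term. -/
def estimatedRegret (v : Fin N) (i : Fin K) (x : History N K) : ℝ :=
  updated G d l x v *
    ((∑ j, prob G d l x.tail v j * delayedEstimate G d l x v j) - delayedEstimate G d l x v i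
      - rate G d l x v / 2 * ∑ j, prob G d l x.tail v j * delayedEstimate G d l x v j ^ 2)

include hK hl in
theorem drift_nonneg (v : Fin N) (j : Fin K) (y : History N K) : 0 ≤ drift G d l v j y :=
  mul_nonneg (mul_nonneg (updated_nonneg G d l y v) (rate_pos G d l hK y v).le)
    (mul_nonneg (prob_pos G d l _ v j).le (delayedEstimate_nonneg G d l hK hl y v j))

include hK hl in
-- All factors of the drift other than the estimate are fixed before the delayed round, so
-- unbiasedness replaces the estimate by a true loss, at most 1, and the probabilities sum to 1.
theorem sum_expect_drift_le (v : Fin N) (T : ℕ) :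
    ∑ j, expect G d l T (drift G d l v j) ≤
      expect G d l T (fun x => updated G d l x v * rate G d l x v) := by
  rcases le_or_gt T d with hT | hT
  · have h0 : ∀ j, expect G d l T (drift G d l v j) = expect G d l T (fun _ => 0) := fun j =>
      expect_congr G d l fun x hx => by
        rw [drift, updated_eq_zero_of_length_le G d l (by omega)]; ring
    simp only [h0, expect_const (by omega : 0 < K), Finset.sum_const_zero]
    exact expect_nonneg G d l (by omega) fun x _ =>
      mul_nonneg (updated_nonneg G d l x v) (rate_pos G d l hK x v).le
  · have h1 : ∀ j, expect G d l T (drift G d l v j) =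
        expect G d l T (fun x => updated G d l x v * rate G d l x v * prob G d l x.tail v j *
          l (T - d) j) := fun j => by
      rw [← expect_mul_delayedEstimate G d l hK hT (((dependsOnDrop_updated G d l v).mul
        (dependsOnDrop_rate G d l v)).mul (dependsOnDrop_prob_tail G d l v j)) v j]
      exact expect_congr G d l fun x _ => by rw [drift]; ring
    simp only [h1]
    rw [← expect_sum G d l (by omega)]
    refine expect_mono G d l fun x _ => ?_
    have h2 := mul_nonneg (updated_nonneg G d l x v) (rate_pos G d l hK x v).le
    calc _ ≤ ∑ j, updated G d l x v * rate G d l x v * prob G d l x.tail v j := by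
          refine Finset.sum_le_sum fun j _ => mul_le_of_le_one_right ?_ (hl _ _).2
          exact mul_nonneg h2 (prob_pos G d l _ v j).le
      _ = _ := by rw [← Finset.mul_sum, sum_prob (by omega), mul_one]

include hK hl in
-- For a history of t rounds this passes from p_{t-d} to p_t. If the last round made an update, the
-- agent has stayed in one epoch for the preceding d rounds and the change of p is bounded by the
-- drift; otherwise the regret is bounded by 1.
theorem instant_regret_le (x : History N K) (hx : d < x.length) (v : Fin N) (i : Fin K)
    {L : Fin K → ℝ} (hL : ∀ j, L j ∈ Set.Icc (0 : ℝ) 1) :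
    ∑ j, prob G d l (x.drop (d + 1)) v j * L j - L i ≤
      (1 - updated G d l x v)
        + (∑ j, updated G d l x v * prob G d l x.tail v j * L j - updated G d l x v * L i)
        + ∑ k ∈ Finset.range d, ∑ j, drift G d l v j (x.drop (k + 1)) := by
  rcases x with _ | ⟨a, h⟩
  · simp at hx
  simp only [List.drop_succ_cons, List.tail_cons]
  have hdr : ∀ k, 0 ≤ ∑ j, drift G d l v j (h.drop k) := fun k =>
    Finset.sum_nonneg fun j _ => drift_nonneg G d l hK hl v j _
  by_cases hg : d < (state G d l (a :: h) v).age
  · have hu : updated G d l (a :: h) v = 1 := if_pos hg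
    simp only [hu, one_mul, sub_self, zero_add]
    rw [Finset.sum_comm]
    have : ∑ j, prob G d l (h.drop d) v j * L j ≤ ∑ j, (prob G d l h v j * L j +
        ∑ k ∈ Finset.range d, drift G d l v j (h.drop k)) := by
      refine Finset.sum_le_sum fun j _ => ?_
      have h1 := prob_drop_sub_le G d l hK hl h v (le_age_of_lt_age_cons G d l hg) j
      have h2 : 0 ≤ ∑ k ∈ Finset.range d, drift G d l v j (h.drop k) :=
        Finset.sum_nonneg fun k _ => drift_nonneg G d l hK hl v j _
      have h3 : (prob G d l (h.drop d) v j - prob G d l h v j) * L j ≤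
          (∑ k ∈ Finset.range d, drift G d l v j (h.drop k)) * L j :=
        mul_le_mul_of_nonneg_right h1 (hL j).1
      have h4 := mul_le_of_le_one_right h2 (hL j).2
      linarith
    rw [Finset.sum_add_distrib] at this
    linarith
  · have hu : updated G d l (a :: h) v = 0 := if_neg hg
    simp only [hu, zero_mul, Finset.sum_const_zero]
    have h1 : ∑ j, prob G d l (h.drop d) v j * L j ≤ 1 := by
      rw [← sum_prob (by omega) G d l (h.drop d) v]
      exact Finset.sum_le_sum fun j _ =>
        mul_le_of_le_one_right (prob_pos G d l _ v j).le (hL j).2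
    have h2 : 0 ≤ ∑ k ∈ Finset.range d, ∑ j, drift G d l v j (h.drop k) :=
      Finset.sum_nonneg fun k _ => hdr k
    linarith [(hL i).1]

include hK hl in
-- The second moment of the estimate is ℓ²/q, with q taken at the delayed round, while the weight in
-- front is the current probability, at most e times the delayed one. This produces the (e/2) Σ p/q
-- of Q.
theorem expect_second_order_le {T : ℕ} (hT : d < T) (v : Fin N) :
    ∑ j, expect G d l T (fun x => updated G d l x v * rate G d l x v * prob G d l x.tail v j *
        (1 / 2) * delayedEstimate G d l x v j ^ 2) ≤
      expect G d l T (fun x => updated G d l x v * rate G d l x v *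
        (delayedQ G d l x v - d)) := by
  have h1 : ∀ j, expect G d l T (fun x => updated G d l x v * rate G d l x v *
        prob G d l x.tail v j * (1 / 2) * delayedEstimate G d l x v j ^ 2) = _ := fun j =>
    expect_mul_delayedEstimate_sq G d l hK hT ((((dependsOnDrop_updated G d l v).mul
      (dependsOnDrop_rate G d l v)).mul (dependsOnDrop_prob_tail G d l v j)).mul
        (dependsOnDrop_const _ (1 / 2))) v j
  simp only [h1]
  rw [← expect_sum G d l (by omega)]
  refine expect_mono G d l fun x hx => ?_
  rcases x with _ | ⟨a, h⟩
  · rw [List.length_nil] at hx; omega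
  rw [List.tail_cons, delayedQ, Qterm, add_sub_cancel_left, List.drop_succ_cons]
  by_cases hg : d < (state G d l (a :: h) v).age
  · have hu : updated G d l (a :: h) v = 1 := if_pos hg
    have hr := rate_pos G d l hK (a :: h) v
    rw [hu, one_mul, Finset.mul_sum, Finset.mul_sum]
    refine Finset.sum_le_sum fun j _ => ?_
    have hq := q_pos G d l hK (h.drop d) v j
    have h2 := prob_le_exp_one_mul G d l hK hl (le_age_of_lt_age_cons G d l hg) j
    have h3 : l (T - d) j ^ 2 ≤ 1 := pow_le_one₀ (hl _ _).1 (hl _ _).2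
    have h4 : l (T - d) j ^ 2 / q G d (prob G d l (h.drop d)) j v ≤
        1 / q G d (prob G d l (h.drop d)) j v := div_le_div_of_nonneg_right h3 hq.le
    have hp := prob_pos G d l (h.drop d) v j
    calc rate G d l (a :: h) v * prob G d l h v j * (1 / 2) *
          (l (T - d) j ^ 2 / q G d (prob G d l (h.drop d)) j v)
        ≤ rate G d l (a :: h) v * (Real.exp 1 * prob G d l (h.drop d) v j) * (1 / 2) *
          (1 / q G d (prob G d l (h.drop d)) j v) := by
          gcongr
      _ = _ := by ring
  · have hu : updated G d l (a :: h) v = 0 := if_neg hg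
    simp [hu]

include hK hl in
/-- The regret of an agent in round `m + 1`. -/
theorem round_regret_le (m : ℕ) (v : Fin N) (i : Fin K) :
    expect G d l m (fun h => ∑ j, prob G d l h v j * l (m + 1) j) - l (m + 1) i ≤
      expect G d l (d + m + 1) (fun x => 1 - updated G d l x v)
        + expect G d l (d + m + 1) (estimatedRegret G d l v i)
        + expect G d l (d + m + 1)
          (fun x => updated G d l x v * rate G d l x v * (delayedQ G d l x v - d))
        + ∑ k ∈ Finset.range d,
          expect G d l (k + m + 1) (fun x => updated G d l x v * rate G d l x v) := by
  -- The round at whose end the estimate for round m + 1 is computed; dropping d + 1 rounds leaves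
  -- the history before round m + 1.
  set t := d + m + 1 with ht
  have hK0 : 0 < K := by omega
  have htd : t - d = m + 1 := by omega
  have hdt : d < t := by omega
  have h0 : expect G d l m (fun h => ∑ j, prob G d l h v j * l (m + 1) j) - l (m + 1) i =
      expect G d l t (fun x => ∑ j, prob G d l (x.drop (d + 1)) v j * l (m + 1) j
        - l (m + 1) i) := by
    rw [expect_sub, expect_const hK0, show t = m + (d + 1) by omega,
      expect_drop G d l hK0 m (d + 1) fun h => ∑ j, prob G d l h v j * l (m + 1) j]
  have h1 := expect_mono G d l (T := t) (f := fun x => ∑ j, prob G d l (x.drop (d + 1)) v j *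
    l (m + 1) j - l (m + 1) i) fun x hx => instant_regret_le G d l hK hl x (by omega) v i
      (L := l (m + 1)) (hl _)
  rw [← h0, expect_add, expect_add, expect_sub G d l t (fun x => ∑ j, _),
    expect_sum G d l hK0 t, expect_sum G d l hK0 t] at h1
  have h2 : ∀ j, expect G d l t (fun x => updated G d l x v * prob G d l x.tail v j *
      l (m + 1) j) = expect G d l t (fun x => updated G d l x v * prob G d l x.tail v j *
      delayedEstimate G d l x v j) := fun j => by
    rw [expect_mul_delayedEstimate G d l hK hdt ((dependsOnDrop_updated G d l v).mul
      (dependsOnDrop_prob_tail G d l v j)), htd]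
  have h3 : expect G d l t (fun x => updated G d l x v * l (m + 1) i) =
      expect G d l t (fun x => updated G d l x v * delayedEstimate G d l x v i) := by
    rw [expect_mul_delayedEstimate G d l hK hdt (dependsOnDrop_updated G d l v), htd]
  have h4 : expect G d l t (estimatedRegret G d l v i) =
      ∑ j, expect G d l t (fun x => updated G d l x v * prob G d l x.tail v j *
        delayedEstimate G d l x v j)
      - expect G d l t (fun x => updated G d l x v * delayedEstimate G d l x v i)
      - ∑ j, expect G d l t (fun x => updated G d l x v * rate G d l x v *
        prob G d l x.tail v j * (1 / 2) * delayedEstimate G d l x v j ^ 2) := by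
    rw [← expect_sum G d l hK0, ← expect_sum G d l hK0, ← expect_sub, ← expect_sub]
    refine expect_congr G d l fun x _ => ?_
    rw [estimatedRegret, mul_sub, mul_sub, Finset.mul_sum, ← mul_assoc, Finset.mul_sum]
    congr 1
    · congr 1
      exact Finset.sum_congr rfl fun j _ => by ring
    · exact Finset.sum_congr rfl fun j _ => by ring
  have h5 := expect_second_order_le G d l hK hl hdt v
  have h6 : ∑ k ∈ Finset.range d, expect G d l t (fun x => ∑ j, drift G d l v j (x.drop (k + 1)))
      ≤ ∑ k ∈ Finset.range d,
          expect G d l (k + m + 1) (fun x => updated G d l x v * rate G d l x v) := by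
    rw [← Finset.sum_range_reflect (fun k => expect G d l (k + m + 1) _)]
    refine Finset.sum_le_sum fun k hk => ?_
    have hk := Finset.mem_range.1 hk
    rw [expect_sum G d l hK0]
    refine le_trans (le_of_eq (Finset.sum_congr rfl fun j _ => ?_))
      (sum_expect_drift_le G d l hK hl v (d - 1 - k + m + 1))
    rw [show t = (d - 1 - k + m + 1) + (k + 1) by omega]
    exact expect_drop G d l hK0 _ (k + 1) (drift G d l v j)
  simp only [h2, h3] at h1
  linarith

/-! ### The regret of an agent -/

theorem sum_range_add_le {f : ℕ → ℝ} (d n T : ℕ) (h : d + n ≤ T) (hf : ∀ t, 0 ≤ f t) :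
    ∑ m ∈ Finset.range n, f (d + m) ≤ ∑ t ∈ Finset.range T, f t := by
  calc ∑ m ∈ Finset.range n, f (d + m)
      ≤ ∑ t ∈ Finset.range d, f t + ∑ m ∈ Finset.range n, f (d + m) :=
        le_add_of_nonneg_left (Finset.sum_nonneg fun t _ => hf t)
    _ = ∑ t ∈ Finset.range (d + n), f t := by rw [Finset.sum_range_add]
    _ ≤ _ := Finset.sum_le_sum_of_subset_of_nonneg (Finset.range_subset_range.2 h)
        fun t _ _ => hf t

include hK hl in
/-- The regret of an agent in all but the last `d` rounds, in terms of the last epoch. -/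
theorem sum_round_regret_le (n : ℕ) (v : Fin N) (i : Fin K) :
    ∑ m ∈ Finset.range n,
        (expect G d l m (fun h => ∑ j, prob G d l h v j * l (m + 1) j) - l (m + 1) i) ≤
      expect G d l (d + n) (fun x => d + (d + 1) * ((state G d l x v).r - r0 K d : ℝ)
        + 9 * epochScale K (state G d l x v).r) := by
  have hK0 : 0 < K := by omega
  have hur : ∀ t, 0 ≤ expect G d l t (fun x => updated G d l x v * rate G d l x v) := fun t =>
    expect_nonneg G d l hK0 fun x _ =>
      mul_nonneg (updated_nonneg G d l x v) (rate_pos G d l hK x v).le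
  have hQd : ∀ x, 0 ≤ delayedQ G d l x v - d := fun x => by
    rw [delayedQ, Qterm, add_sub_cancel_left]
    exact mul_nonneg (by positivity) (Finset.sum_nonneg fun j _ =>
      div_nonneg (prob_pos G d l _ v j).le (q_pos G d l hK _ v j).le)
  have h1 := Finset.sum_le_sum (s := Finset.range n)
    fun m _ => round_regret_le G d l hK hl m v i
  simp only [Finset.sum_add_distrib] at h1
  have hA : ∑ m ∈ Finset.range n, expect G d l (d + m + 1) (fun x => 1 - updated G d l x v) ≤
      ∑ t ∈ Finset.range (d + n), expect G d l (t + 1) (fun x => 1 - updated G d l x v) :=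
    sum_range_add_le (f := fun t => expect G d l (t + 1) (fun x => 1 - updated G d l x v))
      d n _ le_rfl fun t => expect_nonneg G d l hK0 fun x _ =>
        sub_nonneg.2 (updated_le_one G d l x v)
  -- `estimatedRegret` has no sign, so the first `d` rounds cannot be added by monotonicity; they
  -- vanish because no update occurs there.
  have hB : ∑ m ∈ Finset.range n, expect G d l (d + m + 1) (estimatedRegret G d l v i) =
      ∑ t ∈ Finset.range (d + n), expect G d l (t + 1) (estimatedRegret G d l v i) := by
    rw [Finset.sum_range_add, Finset.sum_eq_zero (s := Finset.range d), zero_add]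
    intro t ht
    have ht := Finset.mem_range.1 ht
    rw [← expect_const hK0 G d l (t + 1) 0]
    refine expect_congr G d l fun x hx => ?_
    rw [estimatedRegret, updated_eq_zero_of_length_le G d l (by omega), zero_mul]
  have hC : ∑ m ∈ Finset.range n, expect G d l (d + m + 1)
        (fun x => updated G d l x v * rate G d l x v * (delayedQ G d l x v - d)) ≤
      ∑ t ∈ Finset.range (d + n), expect G d l (t + 1)
        (fun x => updated G d l x v * rate G d l x v * (delayedQ G d l x v - d)) :=
    sum_range_add_le (f := fun t => expect G d l (t + 1)
        (fun x => updated G d l x v * rate G d l x v * (delayedQ G d l x v - d)))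
      d n _ le_rfl fun t => expect_nonneg G d l hK0 fun x _ =>
        mul_nonneg (mul_nonneg (updated_nonneg G d l x v) (rate_pos G d l hK x v).le) (hQd x)
  -- For each of the `d` shifts the sum runs over distinct rounds, so every η is counted at most `d`
  -- times. This restores the d subtracted from Q in `hC`.
  have hD : ∑ m ∈ Finset.range n, ∑ k ∈ Finset.range d, expect G d l (k + m + 1)
        (fun x => updated G d l x v * rate G d l x v) ≤
      ∑ t ∈ Finset.range (d + n), expect G d l (t + 1)
        (fun x => updated G d l x v * rate G d l x v * d) := by
    rw [Finset.sum_comm]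
    calc _ ≤ ∑ k ∈ Finset.range d, ∑ t ∈ Finset.range (d + n), expect G d l (t + 1)
          (fun x => updated G d l x v * rate G d l x v) := by
          refine Finset.sum_le_sum fun k hk => ?_
          have hk := Finset.mem_range.1 hk
          exact sum_range_add_le (f := fun t => expect G d l (t + 1)
            (fun x => updated G d l x v * rate G d l x v)) k n (d + n) (by omega)
            fun t => hur _
      _ = _ := by
          rw [Finset.sum_const, Finset.card_range, nsmul_eq_mul, Finset.mul_sum]
          refine Finset.sum_congr rfl fun t _ => ?_
          rw [← expect_const_mul]
          exact expect_congr G d l fun x _ => by ring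
  have hCD : ∑ t ∈ Finset.range (d + n), expect G d l (t + 1)
        (fun x => updated G d l x v * rate G d l x v * (delayedQ G d l x v - d))
      + ∑ t ∈ Finset.range (d + n), expect G d l (t + 1)
        (fun x => updated G d l x v * rate G d l x v * d)
      = ∑ t ∈ Finset.range (d + n), expect G d l (t + 1)
        (fun x => updated G d l x v * rate G d l x v * delayedQ G d l x v) := by
    rw [← Finset.sum_add_distrib]
    refine Finset.sum_congr rfl fun t _ => ?_
    rw [← expect_add]
    exact expect_congr G d l fun x _ => by ring
  have pA := sum_expect_le_of_potential G d l hK0 (d + n) (fun x => 1 - updated G d l x v)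
    (fun x => ((min (state G d l x v).age d : ℕ) : ℝ) + (d + 1) * ((state G d l x v).r : ℝ))
    fun a h => one_sub_updated_le G d l a h v
  have pB := sum_expect_le_of_potential G d l hK0 (d + n) (estimatedRegret G d l v i)
    (fun x => 4 * epochScale K (state G d l x v).r + Real.log (prob G d l x v i) / rate G d l x v)
    fun a h => updated_mul_regret_le G d l hK hl a h v i
  have pC := sum_expect_le_of_potential G d l hK0 (d + n)
    (fun x => updated G d l x v * rate G d l x v * delayedQ G d l x v)
    (fun x => rate G d l x v * (state G d l x v).acc + 4 * epochScale K (state G d l x v).r)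
    fun a h => updated_mul_rate_mul_delayedQ_le G d l hK a h v
  have hs0 : state G d l [] v = AgentState.start K (r0 K d) := by simp [state]
  have iA : (((min (state G d l [] v).age d : ℕ) : ℝ) + (d + 1) * ((state G d l [] v).r : ℝ))
      = (d + 1) * (r0 K d : ℝ) := by
    rw [hs0]; simp [AgentState.start]
  have iB : 0 ≤ 4 * epochScale K (state G d l [] v).r
      + Real.log (prob G d l [] v i) / rate G d l [] v := by
    rw [prob_of_start G d l hs0, rate, hs0, one_div, Real.log_inv, neg_div]
    simp only [AgentState.start]
    rw [log_div_eta hK]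
    linarith [epochScale_nonneg K (r0 K d)]
  have iC : 0 ≤ rate G d l [] v * (state G d l [] v).acc
      + 4 * epochScale K (state G d l [] v).r := by
    rw [hs0]
    simp only [AgentState.start, mul_zero]
    linarith [epochScale_nonneg K (r0 K d)]
  -- The 9 is 4 from the regret potential, whose logarithm is nonpositive, plus 1 + 4 from the η Q
  -- potential, where η acc ≤ η 2^r.
  have hfin : expect G d l (d + n) (fun x => ((min (state G d l x v).age d : ℕ) : ℝ)
        + (d + 1) * ((state G d l x v).r : ℝ)) - (d + 1) * (r0 K d : ℝ)
      + expect G d l (d + n) (fun x => 4 * epochScale K (state G d l x v).r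
        + Real.log (prob G d l x v i) / rate G d l x v)
      + expect G d l (d + n) (fun x => rate G d l x v * (state G d l x v).acc
        + 4 * epochScale K (state G d l x v).r)
      ≤ expect G d l (d + n) (fun x => d + (d + 1) * ((state G d l x v).r - r0 K d : ℝ)
        + 9 * epochScale K (state G d l x v).r) := by
    rw [← expect_const hK0 G d l (d + n) ((d + 1) * (r0 K d : ℝ)), ← expect_sub, ← expect_add,
      ← expect_add]
    refine expect_mono G d l fun x _ => ?_
    have e1 : ((min (state G d l x v).age d : ℕ) : ℝ) ≤ d := by
      exact_mod_cast min_le_right _ _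
    have e2 : Real.log (prob G d l x v i) / rate G d l x v ≤ 0 :=
      div_nonpos_of_nonpos_of_nonneg
        (Real.log_nonpos (prob_pos G d l x v i).le (prob_le_one G d l hK x v i))
        (rate_pos G d l hK x v).le
    have e3 : rate G d l x v * (state G d l x v).acc ≤ epochScale K (state G d l x v).r := by
      rw [← eta_mul_two_zpow (d := d) hK]
      exact mul_le_mul_of_nonneg_left (acc_le G d l x v) (eta_pos hK _).le
    linarith
  rw [iA] at pA
  linarith

/-! ### The last epoch -/

include hK in
theorem two_zpow_r0_ge : Real.log K * (K * Real.exp 1 * (d + 1)) ^ 2 ≤ (2 : ℝ) ^ r0 K d := by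
  have hK0 : (0 : ℝ) < K := by exact_mod_cast (by omega : 0 < K)
  have hm : (0 : ℝ) < K * Real.exp 1 * (d + 1) := by positivity
  have hlog := log_pos_of_two_le hK
  have h1 : Real.logb 2 (Real.log K) + 2 * Real.logb 2 (K * Real.exp 1 * (d + 1)) ≤
      (r0 K d : ℝ) := Int.le_ceil _
  rw [← Real.rpow_intCast, ← Real.logb_le_iff_le_rpow (by norm_num) (by positivity),
    Real.logb_mul hlog.ne' (by positivity), Real.logb_pow]
  exact_mod_cast h1

include hK in
theorem two_zpow_r0_le : (2 : ℝ) ^ r0 K d ≤ 2 * (Real.log K * (K * Real.exp 1 * (d + 1)) ^ 2) := by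
  have hK0 : (0 : ℝ) < K := by exact_mod_cast (by omega : 0 < K)
  have hm : (0 : ℝ) < K * Real.exp 1 * (d + 1) := by positivity
  have hlog := log_pos_of_two_le hK
  have h1 : (r0 K d : ℝ) <
      Real.logb 2 (Real.log K) + 2 * Real.logb 2 (K * Real.exp 1 * (d + 1)) + 1 :=
    Int.ceil_lt_add_one _
  rw [← Real.rpow_intCast, ← Real.le_logb_iff_rpow_le (by norm_num) (by positivity),
    Real.logb_mul (by norm_num) (by positivity),
    Real.logb_mul hlog.ne' (by positivity), Real.logb_pow, Real.logb_self_eq_one (by norm_num)]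
  push_cast
  linarith

include hK in
-- A single Q never exceeds the initial budget, so the crude growth bound on 2^r can be expressed in
-- units of 2^{r₀}.
theorem add_le_two_zpow_r0 : (d : ℝ) + 2 * K ≤ (2 : ℝ) ^ r0 K d := by
  refine le_trans ?_ (two_zpow_r0_ge d hK)
  have hK2 : (2 : ℝ) ≤ K := by exact_mod_cast hK
  have hd : (0 : ℝ) ≤ d := by positivity
  have hlog : (1 / 2 : ℝ) ≤ Real.log K := by
    have h1 := Real.log_two_gt_d9
    have h2 := Real.log_le_log (by norm_num) hK2
    linarith
  have he := Real.exp_one_gt_d9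
  have h1 : (K : ℝ) * 2 * (d + 1) ≤ K * Real.exp 1 * (d + 1) := by gcongr; linarith
  have h2 : ((K : ℝ) * 2 * (d + 1)) ^ 2 ≤ (K * Real.exp 1 * (d + 1)) ^ 2 := by gcongr
  have h3 : 1 / 2 * ((K : ℝ) * 2 * (d + 1)) ^ 2 ≤
      Real.log K * (K * Real.exp 1 * (d + 1)) ^ 2 := by gcongr
  refine le_trans ?_ h3
  have h4 : 0 ≤ (K : ℝ) * d := by positivity
  nlinarith [mul_nonneg h4 hd, mul_nonneg h4 (by linarith : (0 : ℝ) ≤ K)]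

include hK in
theorem two_zpow_r_le (x : History N K) (v : Fin N) :
    (2 : ℝ) ^ (state G d l x v).r + (state G d l x v).acc ≤
      (2 : ℝ) ^ r0 K d * (1 + x.length) := by
  induction x with
  | nil => simp [state, AgentState.start]
  | cons a h ih =>
    have h1 := two_zpow_add_acc_cons_le G d l hK a h v
    have h2 : (if d < (a :: h).length then delayedQ G d l (a :: h) v else 0) ≤
        (2 : ℝ) ^ r0 K d := by
      refine le_trans ?_ (add_le_two_zpow_r0 d hK)
      split_ifs
      · exact delayedQ_le G d l hK _ v
      · positivity
    rw [List.length_cons]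
    push_cast
    linarith

include hK in
-- Deterministically 2^{r - r₀} ≤ 1 + T ≤ 2T, and 1/ln 2 < 2. Measuring in units of 2^{r₀} keeps K
-- and d out of the logarithm.
theorem r_sub_r0_le {x : History N K} (hx : 1 ≤ x.length) (v : Fin N) :
    ((state G d l x v).r - r0 K d : ℝ) ≤ 1 + 2 * Real.log x.length := by
  have h1 : (2 : ℝ) ^ (state G d l x v).r ≤ (2 : ℝ) ^ r0 K d * (1 + x.length) :=
    le_trans (le_add_of_nonneg_right (acc_nonneg G d l hK x v)) (two_zpow_r_le G d l hK x v)
  have hx' : (1 : ℝ) ≤ x.length := by exact_mod_cast hx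
  have h2 : (2 : ℝ) ^ (state G d l x v).r ≤ (2 : ℝ) ^ r0 K d * (2 * x.length) :=
    h1.trans (mul_le_mul_of_nonneg_left (by linarith) (by positivity))
  have h3 := Real.log_le_log (by positivity) h2
  rw [Real.log_mul (by positivity) (by positivity), Real.log_mul (by norm_num) (by positivity),
    Real.log_zpow, Real.log_zpow] at h3
  have h4 := Real.log_two_gt_d9
  have h5 := Real.log_nonneg hx'
  by_contra! h6
  nlinarith

include hK in
/-- The average over the agents of the mean of `2^r`. -/
theorem sum_expect_two_zpow_le (T : ℕ) :
    ∑ v, expect G d l T (fun x => (2 : ℝ) ^ (state G d l x v).r) ≤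
      N * (2 : ℝ) ^ r0 K d +
        T * (N * d + 3 * (N + K * ((graphPower G d).indepNum : ℝ))) := by
  have hK0 : 0 < K := by omega
  set Y : Fin N → History N K → ℝ := fun v x => if d < x.length then delayedQ G d l x v else 0
    with hY
  have h1 : ∀ v, expect G d l T (fun x => (2 : ℝ) ^ (state G d l x v).r) ≤
      (2 : ℝ) ^ r0 K d + ∑ t ∈ Finset.range T, expect G d l (t + 1) (Y v) := by
    intro v
    -- Signs are reversed because here the increments of the potential are bounded from above.
    have h2 := sum_expect_le_of_potential G d l hK0 T (fun x => -1 * Y v x)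
      (fun x => -1 * ((2 : ℝ) ^ (state G d l x v).r + (state G d l x v).acc))
      fun a h => by
        have := two_zpow_add_acc_cons_le G d l hK a h v
        simp only [hY]
        linarith
    simp only [expect_const_mul, ← Finset.mul_sum] at h2
    have h3 : (2 : ℝ) ^ (state G d l [] v).r + (state G d l [] v).acc = (2 : ℝ) ^ r0 K d := by
      simp [state, AgentState.start]
    have h4 : expect G d l T (fun x => (2 : ℝ) ^ (state G d l x v).r) ≤
        expect G d l T (fun x => (2 : ℝ) ^ (state G d l x v).r + (state G d l x v).acc) :=
      expect_mono G d l fun x _ => le_add_of_nonneg_right (acc_nonneg G d l hK x v)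
    rw [h3] at h2
    linarith
  refine (Finset.sum_le_sum fun v _ => h1 v).trans ?_
  rw [Finset.sum_add_distrib, Finset.sum_comm]
  refine add_le_add (by simp) ?_
  calc _ ≤ ∑ t ∈ Finset.range T, (N * d + 3 * (N + K * ((graphPower G d).indepNum : ℝ))) := by
        refine Finset.sum_le_sum fun t _ => ?_
        rw [← expect_sum G d l hK0, ← expect_const hK0 G d l (t + 1) (N * d + _)]
        refine expect_mono G d l fun x _ => ?_
        simp only [hY]
        split_ifs
        · exact sum_Qterm_le G d (fun v i => prob_pos G d l _ v i)
            fun v => sum_prob hK0 G d l _ v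
        · simp only [Finset.sum_const_zero]
          positivity
    _ = _ := by rw [Finset.sum_const, Finset.card_range, nsmul_eq_mul]

end Run

section Run

variable {N K : ℕ} (G : SimpleGraph (Fin N)) (d : ℕ) (l : ℕ → Fin K → ℝ)
variable (hK : 2 ≤ K) (hl : ∀ t i, l t i ∈ Set.Icc (0 : ℝ) 1)

/-! ### The welfare regret -/

include hK hl in
-- One of the two d's is the initial waiting time; the other pays for the last d rounds, whose
-- estimates are not used by time T.
theorem agent_regret_le {T : ℕ} (hT : 1 ≤ T) (v : Fin N) (i : Fin K) :
    expect G d l T (cumLoss l v) - ∑ t ∈ Finset.Icc 1 T, l t i ≤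
      2 * d + (d + 1) * (1 + 2 * Real.log T)
        + 9 * expect G d l T (fun x => epochScale K (state G d l x v).r) := by
  have hK0 : 0 < K := by omega
  have hlogT : 0 ≤ Real.log T := Real.log_nonneg (by exact_mod_cast hT)
  have hIcc : ∑ t ∈ Finset.Icc 1 T, l t i = ∑ t ∈ Finset.range T, l (t + 1) i := by
    rw [Finset.range_eq_Ico, Finset.sum_Ico_add' (fun t => l t i)]
    rfl
  rw [expect_cumLoss G d l hK0, hIcc, ← Finset.sum_sub_distrib]
  have hE : 0 ≤ expect G d l T (fun x => epochScale K (state G d l x v).r) :=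
    expect_nonneg G d l hK0 fun x _ => epochScale_nonneg _ _
  have hone : ∀ t, expect G d l t (fun h => ∑ j, prob G d l h v j * l (t + 1) j)
      - l (t + 1) i ≤ 1 := by
    intro t
    have h1 : expect G d l t (fun h => ∑ j, prob G d l h v j * l (t + 1) j) ≤
        expect G d l t (fun _ => 1) := by
      refine expect_mono G d l fun h _ => ?_
      rw [← sum_prob hK0 G d l h v]
      exact Finset.sum_le_sum fun j _ =>
        mul_le_of_le_one_right (prob_pos G d l _ v j).le (hl _ _).2
    rw [expect_const hK0] at h1
    linarith [(hl (t + 1) i).1]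
  have hsum : ∀ (s : Finset ℕ), s.card ≤ d → ∑ t ∈ s,
      (expect G d l t (fun h => ∑ j, prob G d l h v j * l (t + 1) j) - l (t + 1) i) ≤ d := by
    intro s hs
    calc _ ≤ ∑ t ∈ s, (1 : ℝ) := Finset.sum_le_sum fun t _ => hone t
      _ = s.card := by simp
      _ ≤ d := by exact_mod_cast hs
  rcases le_or_gt T d with hTd | hTd
  · have h1 := hsum (Finset.range T) (by simpa using hTd)
    have h2 : (0 : ℝ) ≤ d := by positivity
    have h3 : 0 ≤ ((d : ℝ) + 1) * (1 + 2 * Real.log T) := by positivity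
    linarith
  · obtain ⟨n, rfl⟩ : ∃ n, T = d + n := ⟨T - d, by omega⟩
    have h1 := sum_round_regret_le G d l hK hl n v i
    have h2 := hsum (Finset.Ico n (d + n)) (by simp)
    rw [← Finset.sum_range_add_sum_Ico _ (by omega : n ≤ d + n)]
    have h3 : expect G d l (d + n) (fun x => d + (d + 1) * ((state G d l x v).r - r0 K d : ℝ)
        + 9 * epochScale K (state G d l x v).r) ≤
        expect G d l (d + n) (fun x => d + (d + 1) * (1 + 2 * Real.log ((d + n : ℕ) : ℝ))
        + 9 * epochScale K (state G d l x v).r) := by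
      refine expect_mono G d l fun x hx => ?_
      have h4 := r_sub_r0_le G d l hK (x := x) (by omega) v
      rw [hx] at h4
      gcongr
    rw [expect_add G d l (d + n) fun _ =>
        (d : ℝ) + (d + 1) * (1 + 2 * Real.log ((d + n : ℕ) : ℝ)),
      expect_const hK0, expect_const_mul] at h3
    linarith

/-- The tangent bound √y ≤ y/(2λ) + λ/2. Being linear in 2^r, it passes through expectations and
averages, and so replaces Jensen's inequality. -/
theorem epochScale_le {lam : ℝ} (hlam : 0 < lam) (r : ℤ) (hK : 2 ≤ K) :
    epochScale K r ≤ Real.log K / (2 * lam) * (2 : ℝ) ^ r + lam / 2 := by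
  have h2 : (0 : ℝ) < (2 : ℝ) ^ r := by positivity
  have hlog := log_pos_of_two_le hK
  have h1 : epochScale K r ^ 2 = Real.log K * (2 : ℝ) ^ r := Real.sq_sqrt (by positivity)
  have h3 : Real.log K / (2 * lam) * (2 : ℝ) ^ r + lam / 2 - epochScale K r =
      (epochScale K r - lam) ^ 2 / (2 * lam) := by
    have : Real.log K / (2 * lam) * (2 : ℝ) ^ r = epochScale K r ^ 2 / (2 * lam) := by
      rw [h1]; ring
    rw [this]
    field_simp
    ring
  have h4 : 0 ≤ (epochScale K r - lam) ^ 2 / (2 * lam) := by positivity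
  linarith

include hK in
/-- The mean over the agents of the scale of the last epoch. -/
theorem average_expect_epochScale_le (hN : 0 < N) {T : ℕ} :
    1 / (N : ℝ) * ∑ v, expect G d l T (fun x => epochScale K (state G d l x v).r) ≤
      Real.sqrt (Real.log K * ((2 : ℝ) ^ r0 K d +
        3 * (((d : ℝ) + 1 + (K : ℝ) / N * ((graphPower G d).indepNum : ℝ)) * T))) := by
  have hK0 : 0 < K := by omega
  have hN' : (0 : ℝ) < N := by exact_mod_cast hN
  have hlog := log_pos_of_two_le hK
  set M : ℝ := (2 : ℝ) ^ r0 K d +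
        3 * (((d : ℝ) + 1 + (K : ℝ) / N * ((graphPower G d).indepNum : ℝ)) * T) with hM
  have hM0 : 0 < M := by positivity
  -- The optimal tangent point: since M bounds the average of 2^r, both halves of the tangent bound
  -- are at most λ/2.
  set lam := Real.sqrt (Real.log K * M) with hlam
  have hlam0 : 0 < lam := by positivity
  have hlam2 : lam ^ 2 = Real.log K * M := Real.sq_sqrt (by positivity)
  have h1 : ∀ v, expect G d l T (fun x => epochScale K (state G d l x v).r) ≤
      Real.log K / (2 * lam) * expect G d l T (fun x => (2 : ℝ) ^ (state G d l x v).r)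
        + lam / 2 := by
    intro v
    rw [← expect_const hK0 G d l T (lam / 2), ← expect_const_mul, ← expect_add]
    exact expect_mono G d l fun x _ => epochScale_le hlam0 _ hK
  have h2 : ∑ v, expect G d l T (fun x => epochScale K (state G d l x v).r) ≤
      Real.log K / (2 * lam) * (N * M) + N * (lam / 2) := by
    refine (Finset.sum_le_sum fun v _ => h1 v).trans ?_
    rw [Finset.sum_add_distrib, ← Finset.mul_sum]
    refine add_le_add (mul_le_mul_of_nonneg_left ?_ (by positivity)) (by simp)
    refine (sum_expect_two_zpow_le G d l hK T).trans ?_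
    have h3 : (N : ℝ) * M = N * (2 : ℝ) ^ r0 K d +
        T * (3 * (N * d) + 3 * (N + K * ((graphPower G d).indepNum : ℝ))) := by
      rw [hM]
      field_simp
      ring
    rw [h3]
    have h4 : (0 : ℝ) ≤ T * (N * d) := by positivity
    linarith
  have h5 : Real.log K / (2 * lam) * (N * M) + N * (lam / 2) = N * lam := by
    have : Real.log K / (2 * lam) * (N * M) = N * (Real.log K * M) / (2 * lam) := by ring
    rw [this, ← hlam2]
    field_simp
    ring
  rw [h5] at h2
  rw [one_div, inv_mul_le_iff₀ hN']
  exact h2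

include hK in
theorem sqrt_log_mul_two_zpow_r0_le :
    Real.sqrt (Real.log K * (2 : ℝ) ^ r0 K d) ≤ 6 * ((K : ℝ) ^ 2 * (d + 1)) := by
  have hlog := log_pos_of_two_le hK
  have hlogK : Real.log K ≤ K := Real.log_le_self (by positivity)
  have he := Real.exp_one_lt_d9
  rw [Real.sqrt_le_iff]
  refine ⟨by positivity, ?_⟩
  calc Real.log K * (2 : ℝ) ^ r0 K d
      ≤ Real.log K * (2 * (Real.log K * (K * Real.exp 1 * (d + 1)) ^ 2)) :=
        mul_le_mul_of_nonneg_left (two_zpow_r0_le d hK) hlog.le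
    _ ≤ K * (2 * (K * (K * 3 * (d + 1)) ^ 2)) := by gcongr; linarith
    _ ≤ (6 * ((K : ℝ) ^ 2 * (d + 1))) ^ 2 := by
        have : (0 : ℝ) ≤ ((K : ℝ) ^ 2 * (d + 1)) ^ 2 := by positivity
        nlinarith

include hK hl in
theorem regret_le (hN : 0 < N) {T : ℕ} (hT : 1 ≤ T) :
    regret G d l T ≤ 2 * d + (d + 1) * (1 + 2 * Real.log T)
      + 9 * Real.sqrt (Real.log K * ((2 : ℝ) ^ r0 K d +
        3 * (((d : ℝ) + 1 + (K : ℝ) / N * ((graphPower G d).indepNum : ℝ)) * T))) := by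
  have hN' : (0 : ℝ) < N := by exact_mod_cast hN
  have : Nonempty (Fin K) := ⟨⟨0, by omega⟩⟩
  obtain ⟨i, hi⟩ := exists_eq_ciInf_of_finite (f := fun i : Fin K => ∑ t ∈ Finset.Icc 1 T, l t i)
  rw [regret, ← hi]
  have h1 := Finset.sum_le_sum (s := Finset.univ)
    fun v _ => agent_regret_le G d l hK hl hT v i
  rw [Finset.sum_sub_distrib, Finset.sum_add_distrib, ← Finset.mul_sum] at h1
  simp only [Finset.sum_const, Finset.card_univ, Fintype.card_fin, nsmul_eq_mul] at h1
  have h2 := mul_le_mul_of_nonneg_left h1 (by positivity : 0 ≤ 1 / (N : ℝ))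
  have h3 := average_expect_epochScale_le G d l hK hN (T := T)
  have h4 : ∀ c : ℝ, 1 / (N : ℝ) * (N * c) = c := fun c => by field_simp
  rw [mul_sub, mul_add, h4, h4] at h2
  linarith

end Run

/-! ### Splitting the square root and collecting the constants -/

theorem sqrt_add_le_sqrt_add_sqrt {x y : ℝ} (hx : 0 ≤ x) (hy : 0 ≤ y) :
    Real.sqrt (x + y) ≤ Real.sqrt x + Real.sqrt y := by
  rw [Real.sqrt_le_iff]
  refine ⟨by positivity, ?_⟩
  nlinarith [Real.sq_sqrt hx, Real.sq_sqrt hy,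
    mul_nonneg (Real.sqrt_nonneg x) (Real.sqrt_nonneg y)]

theorem log_le_two_mul_sqrt {x : ℝ} (hx : 0 < x) : Real.log x ≤ 2 * Real.sqrt x := by
  have h1 := Real.log_le_sub_one_of_pos (Real.sqrt_pos.2 hx)
  rw [Real.log_sqrt hx.le] at h1
  linarith

end

end Exp3Coop


theorem mainTheorem2 :
    ∃ (C : ℝ) (P : MvPolynomial (Fin 3) ℝ),
      ∀ (N K d : ℕ), 2 ≤ K →
      ∀ (G : SimpleGraph (Fin N)), G.Connected →
      ∀ (l : ℕ → Fin K → ℝ), (∀ t i, l t i ∈ Set.Icc (0 : ℝ) 1) →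
      ∀ T : ℕ, 1 ≤ T →
        Exp3Coop.regret G d l T ≤
          C * (Real.sqrt (Real.log K *
                ((d : ℝ) + 1 + (K : ℝ) / N * (Exp3Coop.graphPower G d).indepNum) * T)
              + d * Real.log T)
            + MvPolynomial.eval ![(N : ℝ), (K : ℝ), (d : ℝ)] P := by
  -- Splitting the square root gives 9 · 2 = 18 copies of S, and 2 ln T ≤ 4√T ≤ 6S adds 6. The
  -- polynomial collects 2d + (d + 1) and 9 · 6 K²(d + 1), the latter from the initial budget
  -- 2^{r₀}.
  refine ⟨24, 3 * MvPolynomial.X 2 + 1 + 54 * (MvPolynomial.X 1 ^ 2 * (MvPolynomial.X 2 + 1)), ?_⟩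
  intro N K d hK G hG l hl T hT
  have hN : 0 < N := by
    obtain ⟨v⟩ := hG.nonempty
    exact v.pos
  have hT0 : (0 : ℝ) < T := by exact_mod_cast hT
  have hlog := Exp3Coop.log_pos_of_two_le hK
  have hlogT : 0 ≤ Real.log T := Real.log_nonneg (by exact_mod_cast hT)
  have hP : MvPolynomial.eval ![(N : ℝ), (K : ℝ), (d : ℝ)]
      (3 * MvPolynomial.X 2 + 1 + 54 * (MvPolynomial.X 1 ^ 2 * (MvPolynomial.X 2 + 1)))
      = 3 * (d : ℝ) + 1 + 54 * ((K : ℝ) ^ 2 * (d + 1)) := by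
    simp
  rw [hP]
  have h1 := Exp3Coop.regret_le G d l hK hl hN hT
  set M : ℝ := (d : ℝ) + 1 + (K : ℝ) / N * (Exp3Coop.graphPower G d).indepNum with hM
  have hM1 : 1 ≤ M := by
    have : 0 ≤ (d : ℝ) + (K : ℝ) / N * (Exp3Coop.graphPower G d).indepNum := by positivity
    linarith
  have hM0 : 0 < M := by linarith
  set S := Real.sqrt (Real.log K * M * T) with hS
  have h2 : Real.sqrt (Real.log K * ((2 : ℝ) ^ Exp3Coop.r0 K d + 3 * (M * T))) ≤
      6 * ((K : ℝ) ^ 2 * (d + 1)) + 2 * S := by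
    have h3 : Real.log K * ((2 : ℝ) ^ Exp3Coop.r0 K d + 3 * (M * T)) =
        Real.log K * (2 : ℝ) ^ Exp3Coop.r0 K d + 3 * (Real.log K * M * T) := by ring
    rw [h3]
    refine (Exp3Coop.sqrt_add_le_sqrt_add_sqrt (by positivity) (by positivity)).trans ?_
    refine add_le_add (Exp3Coop.sqrt_log_mul_two_zpow_r0_le d hK) ?_
    rw [Real.sqrt_mul (by norm_num)]
    refine mul_le_mul_of_nonneg_right ?_ (Real.sqrt_nonneg _)
    rw [Real.sqrt_le_iff]
    norm_num
  -- The regret bound contains (d + 1) ln T, but the target allows only d ln T, which is zero for d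
  -- = 0. The spare ln T is absorbed into the main term, using (ln K) M ≥ 1/2.
  have h4 : Real.sqrt T ≤ 3 / 2 * S := by
    have hlogK : (1 / 2 : ℝ) ≤ Real.log K := by
      have h5 := Real.log_two_gt_d9
      have h6 := Real.log_le_log (by norm_num) (by exact_mod_cast hK : (2 : ℝ) ≤ K)
      linarith
    have h7 : (1 / 2 : ℝ) * 1 ≤ Real.log K * M := mul_le_mul hlogK hM1 zero_le_one hlog.le
    have h8 : (T : ℝ) ≤ 2 * (Real.log K * M * T) := by nlinarith
    calc Real.sqrt T ≤ Real.sqrt (2 * (Real.log K * M * T)) := Real.sqrt_le_sqrt h8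
      _ = Real.sqrt 2 * S := by rw [Real.sqrt_mul (by norm_num)]
      _ ≤ 3 / 2 * S := by
        refine mul_le_mul_of_nonneg_right ?_ (Real.sqrt_nonneg _)
        rw [Real.sqrt_le_iff]
        norm_num
  have h9 := Exp3Coop.log_le_two_mul_sqrt hT0
  have h10 : 0 ≤ (d : ℝ) * Real.log T := by positivity
  linarith
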